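/- Let $A,B,B_0>0$ and $\alpha>\beta>1$. For $N$ particles $(x_k,m_k)\in\mathbb R^3\times\mathbb S^2$, $0\le k\le N-1$, with pairwise distinct positions, let $r_{k\ell}=x_k-x_\ell$ and $$U=\sum_{k}\sum_{\ell<k}\Big(B_0\frac{m_k\cdot m_\ell}{|r_{k\ell}|^{\beta}}-(B+B_0)\frac{(m_k\cdot r_{k\ell})(m_\ell\cdot r_{k\ell})}{|r_{k\ell}|^{\beta+2}}\Big)+\sum_{k}\sum_{\ell<k}\frac{A}{|r_{k\ell}|^{\alpha}},$$ with $U=+\infty$ if two positions coincide. For $P=(p_0,\dots,p_{N-1})\in\mathbb R^N$ let $S_P\in(\mathbb R^3\times\mathbb S^2)^N$ be the configuration $x_k=(p_k,0,0)$, $m_k=(1,0,0)$. A critical spear is a configuration $S_P$ with $p_0\le\dots\le p_{N-1}$ which is a critical point of $U$ on $(\mathbb R^3\times\mathbb S^2)^N$ (in particular, its positions are pairwise distinct). With $\zeta(s)=\sum_{k\ge1}k^{-s}$ put $$\check h=\Big(\frac{\alpha A}{\beta B\zeta(\beta)}\Big)^{\frac1{\alpha-\beta}},\qquad \bar h=\Big(\frac{\alpha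 A\zeta(\alpha)}{\beta B\zeta(\beta)}\Big)^{\frac1{\alpha-\beta}},\qquad \hat h=\Big(\frac{\alpha A}{\beta B}\Big)^{\frac1{\alpha-\beta}}.$$ (i) For every $N$ there is $P_0\in\mathbb R^N$ such that $S_{P_0}$ is a critical spear and $U(S_{P_0})=\min_{P\in\mathbb R^N}U(S_P)$. (ii) Every critical spear satisfies $\check h\le|x_{k-1}-x_k|\le\hat h$ for all $k=1,\dots,N-1$. (iii) For every $\beta\ge3$ there is $\alpha_*=\alpha_*(\beta)$, depending only on $\beta$, such that the following holds whenever $\alpha>\beta$, $\alpha>\alpha_*$ and $A,B,B_0>0$. For every $N$ the critical spear is unique up to translation along the axis: if $S_P$ and $S_Q$ are critical spears of $N$ particles, then $Q=P+(t,\dots,t)$ for some $t\in\mathbb R$. Moreover, there are constants $c,C>0$ independent of $N$ such that, for every $N$, every critical spear of $N$ particles satisfies, for all $k=1,\dots,N-1$, $$\bar h+\frac{c}{N^{\beta-1}}\le|x_{k-1}-x_k|\le\bar h+C\Big(\frac1{N^{\beta-1}}+\frac1{k^{\beta-1}}+\frac1{(N-k)^{\beta-1}}\Big).$$ -/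

import Mathlib

noncomputable section

namespace MagneticChain

/-- Euclidean three-space. -/
abbrev E3 : Type := EuclideanSpace ℝ (Fin 3)

/-- The unit sphere of `ℝ³`, in which the spins live. -/
abbrev S2 : Type := Metric.sphere (0 : E3) 1

/-- Configurations `((x_0, m_0), …, (x_{N-1}, m_{N-1}))` in `(ℝ³ × 𝕊²)^N`. -/
abbrev Config (N : ℕ) : Type := Fin N → E3 × S2

/-- Dipolar interaction of `(x, m)` and `(x', m')`, with `r = x - x'`:
`B₀ (m ⬝ m') / |r|^β - (B + B₀) (m ⬝ r) (m' ⬝ r) / |r|^(β + 2)`. -/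
def dipolarPair (B B₀ β : ℝ) (a b : E3 × S2) : ℝ :=
  B₀ * (inner ℝ (a.2 : E3) (b.2 : E3) / ‖a.1 - b.1‖ ^ β) -
    (B + B₀) * (inner ℝ (a.2 : E3) (a.1 - b.1) * inner ℝ (b.2 : E3) (a.1 - b.1) /
      ‖a.1 - b.1‖ ^ (β + 2))

/-- Soft-sphere repulsion `A / |r|^α`. -/
def repulsivePair (A α : ℝ) (a b : E3 × S2) : ℝ :=
  A * (1 / ‖a.1 - b.1‖ ^ α)

/-- The magnetic-repulsive energy `U = U^d + U^s`: each pair is counted once. -/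
def energy (A B B₀ α β : ℝ) {N : ℕ} (S : Config N) : ℝ :=
  (∑ k : Fin N, ∑ l ∈ Finset.Iio k, dipolarPair B B₀ β (S k) (S l)) +
    ∑ k : Fin N, ∑ l ∈ Finset.Iio k, repulsivePair A α (S k) (S l)

/-- The positions are pairwise distinct. This is the domain of the energy: at a collision the
energy is `+∞` (the repulsion dominates), whereas the real-valued formula takes a junk value. -/
def CollisionFree {N : ℕ} (S : Config N) : Prop :=
  Function.Injective fun k => (S k).1

/-- `S` is a critical point of the energy on the manifold `(ℝ³ × 𝕊²)^N`: the energy is defined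
at `S`, and its derivative at `S` vanishes along every curve in `(ℝ³ × 𝕊²)^N` that passes
through `S` at time `0` and is differentiable there. -/
def IsCriticalPoint (A B B₀ α β : ℝ) {N : ℕ} (S : Config N) : Prop :=
  CollisionFree S ∧
    ∀ γ : ℝ → Config N, γ 0 = S →
      (∀ k, DifferentiableAt ℝ (fun t => (γ t k).1) 0) →
      (∀ k, DifferentiableAt ℝ (fun t => ((γ t k).2 : E3)) 0) →
      HasDerivAt (fun t => energy A B B₀ α β (γ t)) 0 0

/-- The spin `(1, 0, 0)`. -/
def axisSpin : S2 :=
  ⟨EuclideanSpace.single 0 1, by simp⟩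

/-- The aligned configuration `x_k = (p_k, 0, 0)`, `m_k = (1, 0, 0)`. -/
def spear {N : ℕ} (P : Fin N → ℝ) : Config N :=
  fun k => (EuclideanSpace.single 0 (P k), axisSpin)

/-- `P` is ordered, `p_0 ≤ … ≤ p_{N-1}`, and its spear is a critical point of the energy on
`(ℝ³ × 𝕊²)^N`. -/
def IsCriticalSpear (A B B₀ α β : ℝ) {N : ℕ} (P : Fin N → ℝ) : Prop :=
  Monotone P ∧ IsCriticalPoint A B B₀ α β (spear P)

/-- `P` minimizes the energy of the spear among all position vectors in `ℝ^N`, in any order, at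
which the energy is finite, that is, with pairwise distinct entries. -/
def IsMinimizingSpear (A B B₀ α β : ℝ) {N : ℕ} (P : Fin N → ℝ) : Prop :=
  CollisionFree (spear P) ∧
    ∀ Q : Fin N → ℝ, CollisionFree (spear Q) →
      energy A B B₀ α β (spear P) ≤ energy A B B₀ α β (spear Q)

/-- The distance `|x_{k-1} - x_k|` in `ℝ³` between neighbours of the spear, `1 ≤ k ≤ N - 1`. -/
def gap {N : ℕ} (P : Fin N → ℝ) (k : ℕ) (hk : k < N) : ℝ :=
  ‖(spear P ⟨k - 1, lt_of_le_of_lt (Nat.sub_le k 1) hk⟩).1 - (spear P ⟨k, hk⟩).1‖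

/-- `ζ(s) = ∑_{k ≥ 1} 1 / k^s`, for real `s > 1`. -/
def zeta (s : ℝ) : ℝ :=
  ∑' n : ℕ, 1 / ((n : ℝ) + 1) ^ s

/-- The lower distance `(α A / (β B ζ(β)))^(1/(α-β))`. -/
def hCheck (A B α β : ℝ) : ℝ :=
  (α * A / (β * B * zeta β)) ^ (1 / (α - β))

/-- The limit distance `(α A ζ(α) / (β B ζ(β)))^(1/(α-β))`. -/
def hBar (A B α β : ℝ) : ℝ :=
  (α * A * zeta α / (β * B * zeta β)) ^ (1 / (α - β))

/-- The upper distance `(α A / (β B))^(1/(α-β))`. -/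
def hHat (A B α β : ℝ) : ℝ :=
  (α * A / (β * B)) ^ (1 / (α - β))

end MagneticChain

end

open MagneticChain

namespace MagneticChain

/-! ### Sums of powers -/

/-! On the axis the `B₀` terms cancel, and a pair at distance `r` has energy `A r^(-α) - B r^(-β)`.
At an aligned configuration spin velocities are orthogonal to the axis and transversal displacements
do not change distances to first order, so criticality on the full manifold reduces to criticality
along the axis (`isCriticalPoint_spear_iff`). Pushing apart the two halves of the chain at a bond
turns criticality into force balance: the forces of all pairs separated by that bond sum to zero. In
units of `hHat` the force is `pairForce`, repulsive below distance 1 and attractive above it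
(`Balanced`).

Part (ii): across a bond longer than 1 every pair attracts, so nothing can balance. At the shortest
bond `m`, the repulsion of its own two particles is at least `m^(-(α+1))`, while at most `n` pairs
at index distance `n` cross the bond, so the attraction is at most `m^(-(β+1)) ζ(β)`.

Part (i): sorting the particles and cutting all bonds down to `hHat` does not raise the energy, and
very short bonds cost too much, so compactness gives a minimizer; it is a local minimum along every
axial variation, hence critical.

Part (iii): for large `α` the force is steep in the bond itself (slope at least `α - β`), whereas
from second neighbours on it decreases with a slope bounded independently of `α`. The force balance
is then diagonally dominant, and maximum principles apply. In the sup norm they give uniqueness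
(`Balanced.bond_eq`). For the lower bound, the shortest bond is compared with the infinite chain,
whose missing tail has order `N^(1-β)` (`Balanced.tail_le_min_bond`). For the upper bound, the
deviation from the equidistant chain is measured against the weight `endEffect`, which convolution
with the interaction reproduces up to a constant (`sum_bondBox_endEffect_le`). -/

lemma zeta_eq (s : ℝ) : zeta s = ∑' n : ℕ, ((n + 1 : ℕ) : ℝ) ^ (-s) := by
  unfold zeta
  refine tsum_congr fun n => ?_
  rw [Real.rpow_neg (by positivity), one_div]
  push_cast
  rfl

lemma summable_succ_rpow_neg {s : ℝ} (hs : 1 < s) :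
    Summable fun n : ℕ => ((n + 1 : ℕ) : ℝ) ^ (-s) := by
  have h : Summable fun n : ℕ => (n : ℝ) ^ (-s) := Real.summable_nat_rpow.2 (by linarith)
  exact (summable_nat_add_iff 1).2 h

lemma hasSum_zeta {s : ℝ} (hs : 1 < s) :
    HasSum (fun n : ℕ => ((n + 1 : ℕ) : ℝ) ^ (-s)) (zeta s) := by
  rw [zeta_eq]
  exact (summable_succ_rpow_neg hs).hasSum

lemma sum_Ico_one_eq (F : ℕ → ℝ) (M : ℕ) :
    ∑ n ∈ Finset.Ico 1 (M + 1), F n = ∑ n ∈ Finset.range M, F (n + 1) := by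
  rw [Finset.sum_Ico_eq_sum_range]
  simp [add_comm]

lemma sum_rpow_neg_le_zeta {s : ℝ} (hs : 1 < s) (M : ℕ) :
    ∑ n ∈ Finset.Ico 1 M, (n : ℝ) ^ (-s) ≤ zeta s := by
  rcases M with _ | M
  · simpa [zeta_eq] using tsum_nonneg fun n : ℕ => by positivity
  · rw [sum_Ico_one_eq fun n : ℕ => (n : ℝ) ^ (-s)]
    exact sum_le_hasSum _ (fun i _ => by positivity) (hasSum_zeta hs)

lemma one_le_zeta {s : ℝ} (hs : 1 < s) : 1 ≤ zeta s := by
  simpa using sum_rpow_neg_le_zeta hs 2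

lemma zeta_le_zeta {s t : ℝ} (hs : 1 < s) (hst : s ≤ t) : zeta t ≤ zeta s := by
  refine hasSum_le (fun n => ?_) (hasSum_zeta (hs.trans_le hst)) (hasSum_zeta hs)
  exact Real.rpow_le_rpow_of_exponent_le (by simp) (by linarith)

/-- One step of the integral comparison, by the mean value inequality; it telescopes in
`tail_sum_le`. -/
lemma mul_succ_rpow_neg_le {s : ℝ} (hs : 1 < s) {x : ℝ} (hx : 0 < x) :
    (s - 1) * (x + 1) ^ (-s) ≤ x ^ (1 - s) - (x + 1) ^ (1 - s) := by
  have hd : ∀ y : ℝ, 0 < y → HasDerivAt (fun y : ℝ => y ^ (1 - s)) ((1 - s) * y ^ (-s)) y := by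
    intro y hy
    have := Real.hasDerivAt_rpow_const (x := y) (p := 1 - s) (Or.inl hy.ne')
    simpa using this
  have hpos : ∀ y ∈ Set.Icc x (x + 1), 0 < y := fun y hy => hx.trans_le hy.1
  have := (convex_Icc x (x + 1)).image_sub_le_mul_sub_of_deriv_le
    (f := fun y : ℝ => y ^ (1 - s)) (C := (1 - s) * (x + 1) ^ (-s))
    (fun y hy => (hd y (hpos y hy)).continuousAt.continuousWithinAt)
    (fun y hy => (hd y (hpos y (interior_subset hy))).differentiableAt.differentiableWithinAt)
    (fun y hy => by
      have hy' := interior_subset hy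
      rw [(hd y (hpos y hy')).deriv]
      have := Real.rpow_le_rpow_of_nonpos (hpos y hy') hy'.2 (z := -s) (by linarith)
      nlinarith)
    x (by simp) (x + 1) (by simp) (by simp)
  simp only [add_sub_cancel_left, mul_one] at this
  linarith

lemma tail_sum_le {s : ℝ} (hs : 1 < s) {a : ℕ} (ha : 1 ≤ a) (M : ℕ) :
    ∑ n ∈ Finset.Ico a M, (n : ℝ) ^ (-s) ≤ (1 + 1 / (s - 1)) * (a : ℝ) ^ (1 - s) := by
  have ha' : (1 : ℝ) ≤ a := by exact_mod_cast ha
  have hs' : 0 < s - 1 := by linarith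
  have key : ∀ j : ℕ, ∑ n ∈ Finset.Ico a (a + j + 1), (n : ℝ) ^ (-s) ≤
      (a : ℝ) ^ (-s) + 1 / (s - 1) * ((a : ℝ) ^ (1 - s) - ((a + j : ℕ) : ℝ) ^ (1 - s)) := by
    intro j
    induction j with
    | zero => simp
    | succ j ih =>
      rw [Finset.sum_Ico_succ_top (by omega)]
      have h := mul_succ_rpow_neg_le hs (x := ((a + j : ℕ) : ℝ))
        (by push_cast; positivity)
      have h2 : ((a + (j + 1) : ℕ) : ℝ) = ((a + j : ℕ) : ℝ) + 1 := by push_cast; ring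
      have h3 : ((a + j + 1 : ℕ) : ℝ) = ((a + j : ℕ) : ℝ) + 1 := by push_cast; ring
      rw [← add_assoc] at *
      rw [h3]
      have h4 : (((a + j : ℕ) : ℝ) + 1) ^ (-s) ≤ 1 / (s - 1) *
          (((a + j : ℕ) : ℝ) ^ (1 - s) - (((a + j : ℕ) : ℝ) + 1) ^ (1 - s)) := by
        rw [one_div, ← div_eq_inv_mul, le_div_iff₀ hs']
        linarith
      linarith
  -- The first term lies outside the telescoping sum and accounts for the summand 1 in the constant.
  have hle : (a : ℝ) ^ (-s) ≤ (a : ℝ) ^ (1 - s) :=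
    Real.rpow_le_rpow_of_exponent_le ha' (by linarith)
  have hp : (0 : ℝ) ≤ 1 / (s - 1) := by positivity
  rcases lt_or_ge a M with h | h
  · obtain ⟨j, rfl⟩ := Nat.exists_eq_add_of_lt h
    refine (key j).trans ?_
    have : (0 : ℝ) ≤ 1 / (s - 1) * ((a + j : ℕ) : ℝ) ^ (1 - s) := by positivity
    linarith
  · rw [Finset.Ico_eq_empty_of_le h]
    simp only [Finset.sum_empty]
    positivity

lemma le_tail_sum {s : ℝ} (hs : 0 < s) {a : ℕ} (ha : 1 ≤ a) :
    (2 : ℝ) ^ (-s) * (a : ℝ) ^ (1 - s) ≤ ∑ n ∈ Finset.Ico a (2 * a), (n : ℝ) ^ (-s) := by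
  have ha' : (0 : ℝ) < a := by exact_mod_cast ha
  have h : ∀ n ∈ Finset.Ico a (2 * a), ((2 * a : ℕ) : ℝ) ^ (-s) ≤ (n : ℝ) ^ (-s) := by
    intro n hn
    rw [Finset.mem_Ico] at hn
    exact Real.rpow_le_rpow_of_nonpos (by exact_mod_cast (by omega : 0 < n))
      (by exact_mod_cast hn.2.le) (by linarith)
  refine le_trans (le_of_eq ?_) (Finset.card_nsmul_le_sum _ _ _ h)
  rw [Nat.card_Ico, nsmul_eq_mul]
  push_cast
  rw [show 2 * a - a = a by omega, Real.mul_rpow (by norm_num) ha'.le,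
    show (1 - s) = 1 + -s by ring, Real.rpow_add ha', Real.rpow_one]
  ring

/-! ### Pairs of particles separated by a bond -/

/-- The pairs `(i, j)` with `i ≤ p < j < N`. -/
def bondBox (p N : ℕ) : Finset (ℕ × ℕ) :=
  Finset.range (p + 1) ×ˢ Finset.Ico (p + 1) N

lemma mem_bondBox {p N : ℕ} {q : ℕ × ℕ} : q ∈ bondBox p N ↔ q.1 ≤ p ∧ p < q.2 ∧ q.2 < N := by
  simp [bondBox]

/-- A pair at distance `n` is determined by the offset `a = p - i` of its left end; `a < n`, `a ≤ p`
and `p - a + n ≤ N - 1` confine `a` to an interval. Truncated subtraction covers the cases without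
loss at the right end. -/
lemma card_bondBox_dist {p N n : ℕ} (hp : p + 1 < N) (hn : 1 ≤ n) :
    ((bondBox p N).filter fun q => q.2 - q.1 = n).card =
      min n (p + 1) - (n - (N - 1 - p)) := by
  rw [← Nat.card_Ico]
  refine Finset.card_bij' (fun q _ => p - q.1) (fun a _ => (p - a, p - a + n)) ?_ ?_ ?_ ?_
  · rintro ⟨i, j⟩ h
    simp only [Finset.mem_filter, mem_bondBox, Finset.mem_Ico] at h ⊢
    omega
  · intro a h
    simp only [Finset.mem_filter, mem_bondBox, Finset.mem_Ico] at h ⊢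
    omega
  · rintro ⟨i, j⟩ h
    simp only [Finset.mem_filter, mem_bondBox, Prod.mk.injEq] at h ⊢
    omega
  · intro a h
    simp only [Finset.mem_Ico] at h ⊢
    omega

lemma sum_bondBox_dist {p N : ℕ} (hp : p + 1 < N) (F : ℕ → ℝ) {M : ℕ} (hM : N ≤ M) :
    ∑ q ∈ bondBox p N, F (q.2 - q.1) =
      ∑ n ∈ Finset.Ico 1 M, ((min n (p + 1) - (n - (N - 1 - p)) : ℕ) : ℝ) * F n := by
  rw [← Finset.sum_fiberwise_of_maps_to (t := Finset.Ico 1 M) (g := fun q : ℕ × ℕ => q.2 - q.1)]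
  · refine Finset.sum_congr rfl fun n hn => ?_
    rw [← card_bondBox_dist hp (Finset.mem_Ico.1 hn).1, ← nsmul_eq_mul, ← Finset.sum_const]
    refine Finset.sum_congr rfl fun q hq => ?_
    rw [(Finset.mem_filter.1 hq).2]
  · intro q hq
    rw [mem_bondBox] at hq
    rw [Finset.mem_Ico]
    omega

/-- At most `n` pairs at distance `n` are separated by a given bond. -/
lemma sum_bondBox_dist_le {p N : ℕ} (hp : p + 1 < N) {F : ℕ → ℝ} (hF : ∀ n, 2 ≤ n → 0 ≤ F n) :
    ∑ q ∈ bondBox p N, F (q.2 - q.1) ≤ ∑ n ∈ Finset.Ico 1 N, (n : ℝ) * F n := by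
  rw [sum_bondBox_dist hp F le_rfl]
  refine Finset.sum_le_sum fun n hn => ?_
  rw [Finset.mem_Ico] at hn
  -- Exactly one pair at distance 1 crosses the bond, so no sign of `F 1` is needed: the
  -- nearest-neighbour force may be repulsive.
  rcases hn.1.eq_or_lt with h | h
  · subst h
    rw [show min 1 (p + 1) - (1 - (N - 1 - p)) = 1 by omega]
  · exact mul_le_mul_of_nonneg_right (by exact_mod_cast (by omega)) (hF n h)

/-- The pairs at distance `n` missing at a bond reach beyond one of the two ends. -/
lemma le_sum_bondBox_dist {p N : ℕ} (hp : p + 1 < N) {F : ℕ → ℝ} (hF : ∀ n, 2 ≤ n → 0 ≤ F n)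
    {M : ℕ} (hM : N ≤ M) :
    ∑ n ∈ Finset.Ico 1 M, (n : ℝ) * F n ≤ ∑ q ∈ bondBox p N, F (q.2 - q.1) +
      (∑ n ∈ Finset.Ico (p + 2) M, (n : ℝ) * F n +
        ∑ n ∈ Finset.Ico (N - p) M, (n : ℝ) * F n) := by
  have hsub : ∀ a, 1 ≤ a → ∑ n ∈ Finset.Ico a M, (n : ℝ) * F n =
      ∑ n ∈ Finset.Ico 1 M, if a ≤ n then (n : ℝ) * F n else 0 := by
    intro a ha
    rw [← Finset.sum_filter]
    refine Finset.sum_congr ?_ fun _ _ => rfl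
    ext n
    simp only [Finset.mem_filter, Finset.mem_Ico]
    omega
  rw [sum_bondBox_dist hp F hM, hsub (p + 2) (by omega), hsub (N - p) (by omega),
    ← Finset.sum_add_distrib, ← Finset.sum_add_distrib]
  refine Finset.sum_le_sum fun n hn => ?_
  rw [Finset.mem_Ico] at hn
  rcases hn.1.eq_or_lt with h | h
  · subst h
    rw [show min 1 (p + 1) - (1 - (N - 1 - p)) = 1 by omega, if_neg (by omega), if_neg (by omega)]
    simp
  · have h0 := hF n h
    have h1 : 0 ≤ (n : ℝ) * F n := by positivity
    have h2 : 0 ≤ ((min n (p + 1) - (n - (N - 1 - p)) : ℕ) : ℝ) * F n := by positivity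
    split_ifs with h3 h4 h4
    · linarith
    · linarith
    · linarith
    · rw [show min n (p + 1) - (n - (N - 1 - p)) = n by omega]
      linarith

/-! ### The pair force -/

/-- The normalized attraction between two particles at distance `r`. -/
noncomputable def pairForce (α β r : ℝ) : ℝ :=
  r ^ (-(β + 1)) - r ^ (-(α + 1))

lemma hasDerivAt_pairForce (α β : ℝ) {r : ℝ} (hr : 0 < r) :
    HasDerivAt (pairForce α β)
      ((α + 1) * r ^ (-(α + 2)) - (β + 1) * r ^ (-(β + 2))) r := by
  have h1 := Real.hasDerivAt_rpow_const (x := r) (p := -(β + 1)) (Or.inl hr.ne')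
  have h2 := Real.hasDerivAt_rpow_const (x := r) (p := -(α + 1)) (Or.inl hr.ne')
  refine (h1.sub h2).congr_deriv ?_
  rw [show -(β + 1) - 1 = -(β + 2) by ring, show -(α + 1) - 1 = -(α + 2) by ring]
  ring

lemma pairForce_eq (α β : ℝ) {r : ℝ} (hr : 0 < r) :
    pairForce α β r = r ^ (-(β + 1)) * (1 - r ^ (-(α - β))) := by
  unfold pairForce
  rw [mul_sub, ← Real.rpow_add hr]
  ring_nf

lemma pairForce_pos {α β r : ℝ} (hαβ : β < α) (hr : 1 < r) : 0 < pairForce α β r := by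
  unfold pairForce
  have := Real.rpow_lt_rpow_of_exponent_lt hr (show -(α + 1) < -(β + 1) by linarith)
  linarith

lemma pairForce_nonneg {α β r : ℝ} (hαβ : β < α) (hr : 1 ≤ r) : 0 ≤ pairForce α β r := by
  unfold pairForce
  have := Real.rpow_le_rpow_of_exponent_le hr (show -(α + 1) ≤ -(β + 1) by linarith)
  linarith

lemma pairForce_le {α β r : ℝ} (hr : 0 < r) : pairForce α β r ≤ r ^ (-(β + 1)) := by
  unfold pairForce
  have : 0 < r ^ (-(α + 1)) := by positivity
  linarith

/-- Below distance `1` the pair force is steep. -/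
lemma mul_sub_le_pairForce_sub {α β : ℝ} (hβ : 1 < β) (hαβ : β < α) {r r' : ℝ} (hr : 0 < r)
    (hrr' : r ≤ r') (hr' : r' ≤ 1) :
    (α - β) * (r' - r) ≤ pairForce α β r' - pairForce α β r := by
  have hpos : ∀ y ∈ Set.Icc r r', 0 < y := fun y hy => hr.trans_le hy.1
  have hd := fun y hy => hasDerivAt_pairForce α β (hpos y hy)
  refine (convex_Icc r r').mul_sub_le_image_sub_of_le_deriv
    (fun y hy => (hd y hy).continuousAt.continuousWithinAt)
    (fun y hy => (hd y (interior_subset hy)).differentiableAt.differentiableWithinAt)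
    (fun y hy => ?_) r (by simp [hrr']) r' (by simp [hrr']) hrr'
  have hy' := interior_subset hy
  have hy0 := hpos y hy'
  have hy1 : y ≤ 1 := hy'.2.trans hr'
  rw [(hd y hy').deriv]
  have h1 : y ^ (-(β + 2)) ≤ y ^ (-(α + 2)) :=
    Real.rpow_le_rpow_of_exponent_ge hy0 hy1 (by linarith)
  have h2 : 1 ≤ y ^ (-(β + 2)) :=
    Real.one_le_rpow_of_pos_of_le_one_of_nonpos hy0 hy1 (by linarith)
  nlinarith

/-- Beyond a suitable distance `R` the pair force decreases, with derivative of order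
`R ^ (-(β + 2))`. -/
lemma pairForce_sub_bounds {α β : ℝ} (hβ : 1 < β) (hαβ : β < α) {R r r' : ℝ} (hR : 0 < R)
    (hRα : (α + 1) * R ^ (-(α - β)) ≤ β + 1) (hr : R ≤ r) (hrr' : r ≤ r') :
    -((β + 1) * R ^ (-(β + 2)) * (r' - r)) ≤ pairForce α β r' - pairForce α β r ∧
      pairForce α β r' - pairForce α β r ≤ 0 := by
  have hpos : ∀ y ∈ Set.Icc r r', 0 < y := fun y hy => (hR.trans_le hr).trans_le hy.1
  have hd := fun y hy => hasDerivAt_pairForce α β (hpos y hy)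
  constructor
  · have := (convex_Icc r r').mul_sub_le_image_sub_of_le_deriv
      (C := -((β + 1) * R ^ (-(β + 2))))
      (fun y hy => (hd y hy).continuousAt.continuousWithinAt)
      (fun y hy => (hd y (interior_subset hy)).differentiableAt.differentiableWithinAt)
      (fun y hy => ?_) r (by simp [hrr']) r' (by simp [hrr']) hrr'
    · linarith
    have hy' := interior_subset hy
    have hy0 := hpos y hy'
    rw [(hd y hy').deriv]
    have h1 : y ^ (-(β + 2)) ≤ R ^ (-(β + 2)) :=
      Real.rpow_le_rpow_of_nonpos hR (hr.trans hy'.1) (by linarith)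
    have h2 : 0 ≤ (α + 1) * y ^ (-(α + 2)) := by
      have : 0 < α + 1 := by linarith
      positivity
    nlinarith
  · have := (convex_Icc r r').image_sub_le_mul_sub_of_deriv_le
      (C := 0)
      (fun y hy => (hd y hy).continuousAt.continuousWithinAt)
      (fun y hy => (hd y (interior_subset hy)).differentiableAt.differentiableWithinAt)
      (fun y hy => ?_) r (by simp [hrr']) r' (by simp [hrr']) hrr'
    · linarith
    have hy' := interior_subset hy
    have hy0 := hpos y hy'
    rw [(hd y hy').deriv]
    have h1 : y ^ (-(α - β)) ≤ R ^ (-(α - β)) :=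
      Real.rpow_le_rpow_of_nonpos hR (hr.trans hy'.1) (by linarith)
    have h2 : y ^ (-(α + 2)) = y ^ (-(β + 2)) * y ^ (-(α - β)) := by
      rw [← Real.rpow_add hy0]
      ring_nf
    have h3 : 0 < y ^ (-(β + 2)) := by positivity
    have h4 : (α + 1) * y ^ (-(α - β)) ≤ β + 1 :=
      le_trans (mul_le_mul_of_nonneg_left h1 (by linarith)) hRα
    rw [h2]
    nlinarith

/-- The multiplicity `n` of the distance `n` cancels one power. -/
lemma sum_bondBox_rpow_le {s : ℝ} (hs : 1 < s) {p N : ℕ} (hp : p + 1 < N) :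
    ∑ q ∈ bondBox p N, ((q.2 - q.1 : ℕ) : ℝ) ^ (-(s + 1)) ≤ zeta s := by
  refine (sum_bondBox_dist_le hp (F := fun n : ℕ => (n : ℝ) ^ (-(s + 1)))
    fun n _ => by positivity).trans (le_trans (le_of_eq ?_) (sum_rpow_neg_le_zeta hs N))
  refine Finset.sum_congr rfl fun n hn => ?_
  have hn : (0 : ℝ) < n := by exact_mod_cast (Finset.mem_Ico.1 hn).1
  rw [neg_add, Real.rpow_add hn, Real.rpow_neg_one]
  field_simp

lemma self_mem_bondBox {p N : ℕ} (hp : p + 1 < N) : (p, p + 1) ∈ bondBox p N := by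
  rw [mem_bondBox]
  simp [hp]

lemma two_le_of_mem_bondBox {p N : ℕ} {q : ℕ × ℕ} (hq : q ∈ bondBox p N) (hne : q ≠ (p, p + 1)) :
    2 ≤ q.2 - q.1 := by
  obtain ⟨i, j⟩ := q
  rw [mem_bondBox] at hq
  simp only [ne_eq, Prod.mk.injEq] at hq hne
  omega

/-- The normalized forces of the chain at positions `y 0 < … < y (N - 1)` balance at every bond. -/
structure Balanced (α β : ℝ) (N : ℕ) (y : ℕ → ℝ) : Prop where
  lt_succ : ∀ p, p + 1 < N → y p < y (p + 1)
  force : ∀ p, p + 1 < N → ∑ q ∈ bondBox p N, pairForce α β (y q.2 - y q.1) = 0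

/-! ### A priori bounds on the bonds of a balanced chain -/

section Chain

variable {N : ℕ} {y : ℕ → ℝ}

lemma mul_le_sub_of_le_bonds {m : ℝ} (hm : ∀ p, p + 1 < N → m ≤ y (p + 1) - y p) {i j : ℕ}
    (hij : i ≤ j) (hj : j < N) : ((j - i : ℕ) : ℝ) * m ≤ y j - y i := by
  rw [← Finset.sum_Ico_sub y hij, ← Nat.card_Ico, ← nsmul_eq_mul]
  refine Finset.card_nsmul_le_sum _ _ _ fun l hl => hm l ?_
  rw [Finset.mem_Ico] at hl
  omega

lemma bond_le_sub (hy : ∀ p, p + 1 < N → y p < y (p + 1)) {p : ℕ} {q : ℕ × ℕ}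
    (hq : q ∈ bondBox p N) : y (p + 1) - y p ≤ y q.2 - y q.1 := by
  rw [mem_bondBox] at hq
  have h0 : ∀ p, p + 1 < N → 0 ≤ y (p + 1) - y p := fun p hp => (sub_pos.2 (hy p hp)).le
  have h1 := mul_le_sub_of_le_bonds h0 hq.1 (by omega)
  have h2 := mul_le_sub_of_le_bonds h0 (show p + 1 ≤ q.2 by omega) hq.2.2
  rw [mul_zero] at h1 h2
  linarith

lemma exists_min_bond (f : ℕ → ℝ) {p : ℕ} (hp : p + 1 < N) :
    ∃ p₀, p₀ + 1 < N ∧ ∀ l, l + 1 < N → f p₀ ≤ f l := by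
  obtain ⟨a, ha, h⟩ := Finset.exists_min_image (Finset.range (N - 1)) f
    ⟨p, by rw [Finset.mem_range]; omega⟩
  simp only [Finset.mem_range] at ha h
  exact ⟨a, by omega, fun l hl => h l (by omega)⟩

variable {α β : ℝ}

/-- Across a bond longer than 1 all pairs would attract strictly. -/
lemma Balanced.bond_le_one (hαβ : β < α) (hy : Balanced α β N y) {p : ℕ} (hp : p + 1 < N) :
    y (p + 1) - y p ≤ 1 := by
  by_contra! h
  have : 0 < ∑ q ∈ bondBox p N, pairForce α β (y q.2 - y q.1) :=
    Finset.sum_pos (fun q hq => pairForce_pos hαβ (h.trans_le (bond_le_sub hy.lt_succ hq)))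
      ⟨_, self_mem_bondBox hp⟩
  exact this.ne' (hy.force p hp)

/-- At the shortest bond, its own repulsion is weighed against the largest possible attraction, that
of an infinite chain with this spacing. -/
lemma Balanced.bond_rpow_le_zeta (hβ : 1 < β) (hαβ : β < α) (hy : Balanced α β N y) {p : ℕ}
    (hp : p + 1 < N) : (y (p + 1) - y p) ^ (-(α - β)) ≤ zeta β := by
  obtain ⟨p₀, hp₀, hmin⟩ := exists_min_bond (fun p => y (p + 1) - y p) hp
  set m := y (p₀ + 1) - y p₀ with hm
  have hm0 : 0 < m := sub_pos.2 (hy.lt_succ _ hp₀)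
  refine (Real.rpow_le_rpow_of_nonpos hm0 (hmin p hp) (by linarith)).trans ?_
  have h0 := hy.force p₀ hp₀
  unfold pairForce at h0
  rw [Finset.sum_sub_distrib, sub_eq_zero] at h0
  have h1 : m ^ (-(α + 1)) ≤ ∑ q ∈ bondBox p₀ N, (y q.2 - y q.1) ^ (-(α + 1)) :=
    Finset.single_le_sum (f := fun q : ℕ × ℕ => (y q.2 - y q.1) ^ (-(α + 1)))
      (fun q hq => Real.rpow_nonneg (hm0.le.trans (bond_le_sub hy.lt_succ hq)) _)
      (self_mem_bondBox hp₀)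
  have h2 : ∑ q ∈ bondBox p₀ N, (y q.2 - y q.1) ^ (-(β + 1)) ≤ m ^ (-(β + 1)) * zeta β := by
    refine le_trans ?_ (mul_le_mul_of_nonneg_left (sum_bondBox_rpow_le hβ hp₀) (by positivity))
    rw [Finset.mul_sum]
    refine Finset.sum_le_sum fun q hq => ?_
    have hq' := mem_bondBox.1 hq
    have hn : (0 : ℝ) < ((q.2 - q.1 : ℕ) : ℝ) := by exact_mod_cast (by omega)
    rw [← Real.mul_rpow hm0.le hn.le, mul_comm]
    exact Real.rpow_le_rpow_of_nonpos (by positivity)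
      (mul_le_sub_of_le_bonds hmin (by omega) hq'.2.2) (by linarith)
  have h3 : m ^ (-(α + 1)) = m ^ (-(β + 1)) * m ^ (-(α - β)) := by
    rw [← Real.rpow_add hm0]
    ring_nf
  have h4 : 0 < m ^ (-(β + 1)) := by positivity
  rw [h0] at h2
  rw [h3] at h1
  exact le_of_mul_le_mul_left (h1.trans h2) h4

end Chain

/-! ### Stiff repulsion -/

/-- The constant in the discrete convolution estimate `sum_bondBox_endEffect_le`. -/
noncomputable def convConst (β : ℝ) : ℝ :=
  2 ^ (β - 1) * (zeta β + (1 + 1 / (β - 1)))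

/-- The exponent `α` of the repulsion is large, depending on `β`. -/
structure StiffExponent (α β : ℝ) : Prop where
  one_lt : 1 < β
  lt : β < α
  -- Equivalently `β + 2 ≤ α - β`: powers `u^(-s)` with `s ≤ β + 2` are controlled by `u^(-(α-β)) ≤
  -- ζ(β)`.
  two_mul_le : 2 * β + 2 ≤ α
  -- The pair force decreases beyond twice the smallest admissible bond.
  decreasing : (α + 1) * (2 ^ (-(α - β)) * zeta β) ≤ β + 1
  -- From second neighbours on, repulsion is at most half the attraction.
  half : 2 ^ (-(α - β)) * zeta β ≤ 1 / 2
  -- Diagonal dominance, with margin 1.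
  stiff : (β + 1) * zeta β * convConst β + 1 ≤ α - β

/-- Source of `α_*`: `ζ(β)` and `convConst β` do not involve `α`, and `α 2^(-α)` tends to 0. -/
lemma eventually_stiffExponent {β : ℝ} (hβ : 1 < β) :
    ∀ᶠ α in Filter.atTop, StiffExponent α β := by
  have h0 : Filter.Tendsto (fun α : ℝ => (2 : ℝ) ^ (-α)) Filter.atTop (nhds 0) := by
    have := tendsto_rpow_atTop_of_base_lt_one (1 / 2 : ℝ) (by norm_num) (by norm_num)
    refine this.congr fun x => ?_
    rw [Real.rpow_neg (by norm_num), one_div, Real.inv_rpow (by norm_num)]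
  have h1 : Filter.Tendsto (fun α : ℝ => α * (2 : ℝ) ^ (-α)) Filter.atTop (nhds 0) := by
    have := tendsto_rpow_mul_exp_neg_mul_atTop_nhds_zero 1 (Real.log 2) (Real.log_pos (by norm_num))
    refine this.congr fun x => ?_
    rw [Real.rpow_one, Real.rpow_def_of_pos (by norm_num)]
    ring_nf
  have e : ∀ α : ℝ, (2 : ℝ) ^ (-(α - β)) = 2 ^ (-α) * 2 ^ β := by
    intro α
    rw [← Real.rpow_add (by norm_num)]
    ring_nf
  have h2 : Filter.Tendsto (fun α : ℝ => (2 : ℝ) ^ (-(α - β)) * zeta β) Filter.atTop (nhds 0) := by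
    have := (h0.mul_const (2 ^ β)).mul_const (zeta β)
    rw [zero_mul, zero_mul] at this
    exact this.congr fun x => by rw [e]
  have h3 : Filter.Tendsto (fun α : ℝ => (α + 1) * ((2 : ℝ) ^ (-(α - β)) * zeta β))
      Filter.atTop (nhds 0) := by
    have := ((h1.add h0).mul_const (2 ^ β)).mul_const (zeta β)
    rw [zero_add, zero_mul, zero_mul] at this
    exact this.congr fun x => by rw [e]; ring
  filter_upwards [Filter.eventually_gt_atTop β, Filter.eventually_ge_atTop (2 * β + 2),
    h3.eventually_le_const (show 0 < β + 1 by linarith),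
    h2.eventually_le_const (show (0 : ℝ) < 1 / 2 by norm_num),
    Filter.eventually_ge_atTop ((β + 1) * zeta β * convConst β + 1 + β)] with α a1 a2 a3 a4 a5
  exact ⟨hβ, a1, a2, a3, a4, by linarith⟩

lemma zeta_le_convConst {β : ℝ} (hβ : 1 < β) : zeta β ≤ convConst β := by
  unfold convConst
  have h1 := one_le_zeta hβ
  have h2 : (1 : ℝ) ≤ 2 ^ (β - 1) := Real.one_le_rpow (by norm_num) (by linarith)
  have h3 : 0 ≤ 1 / (β - 1) := one_div_nonneg.2 (by linarith)
  nlinarith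

section Stiff

variable {α β : ℝ}

lemma StiffExponent.rpow_le (h : StiffExponent α β) {u : ℝ} (hu0 : 0 < u)
    (hu : u ^ (-(α - β)) ≤ zeta β) {n : ℕ} (hn : 2 ≤ n) :
    ((n : ℝ) * u) ^ (-(α - β)) ≤ 2 ^ (-(α - β)) * zeta β := by
  rw [Real.mul_rpow (by positivity) hu0.le]
  have h2 : (n : ℝ) ^ (-(α - β)) ≤ 2 ^ (-(α - β)) :=
    Real.rpow_le_rpow_of_nonpos (by norm_num) (by exact_mod_cast hn) (by linarith [h.lt])
  exact mul_le_mul h2 hu (by positivity) (by positivity)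

lemma StiffExponent.rpow_neg_le_zeta (h : StiffExponent α β) {u : ℝ} (hu0 : 0 < u) (hu1 : u ≤ 1)
    (hu : u ^ (-(α - β)) ≤ zeta β) {s : ℝ} (hs : s ≤ β + 2) : u ^ (-s) ≤ zeta β :=
  le_trans (Real.rpow_le_rpow_of_exponent_ge hu0 hu1 (by linarith [h.two_mul_le])) hu

/-- The general monotonicity bound with `R = n u`; the factor `u^(-(β+2))` is absorbed into `ζ(β)`,
which makes the constant independent of `α`. -/
lemma StiffExponent.pairForce_sub_bounds (h : StiffExponent α β) {u : ℝ} (hu0 : 0 < u)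
    (hu1 : u ≤ 1) (hu : u ^ (-(α - β)) ≤ zeta β) {n : ℕ} (hn : 2 ≤ n) {r r' : ℝ}
    (hr : (n : ℝ) * u ≤ r) (hrr' : r ≤ r') :
    -((β + 1) * zeta β * (n : ℝ) ^ (-(β + 2)) * (r' - r)) ≤
        pairForce α β r' - pairForce α β r ∧
      pairForce α β r' - pairForce α β r ≤ 0 := by
  have hn0 : (0 : ℝ) < n := by exact_mod_cast (by omega)
  have hα : 0 ≤ α + 1 := by linarith [h.one_lt, h.lt]
  have h1 := MagneticChain.pairForce_sub_bounds h.one_lt h.lt (mul_pos hn0 hu0)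
    ((mul_le_mul_of_nonneg_left (h.rpow_le hu0 hu hn) hα).trans h.decreasing) hr hrr'
  refine ⟨le_trans ?_ h1.1, h1.2⟩
  rw [neg_le_neg_iff]
  refine mul_le_mul_of_nonneg_right ?_ (by linarith)
  rw [Real.mul_rpow hn0.le hu0.le, mul_assoc (β + 1), mul_comm (zeta β)]
  have := h.rpow_neg_le_zeta hu0 hu1 hu le_rfl
  have hβ := h.one_lt
  gcongr

lemma StiffExponent.le_pairForce (h : StiffExponent α β) {u : ℝ} (hu0 : 0 < u)
    (hu1 : u ≤ 1) (hu : u ^ (-(α - β)) ≤ zeta β) {n : ℕ} (hn : 2 ≤ n) :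
    1 / 2 * (n : ℝ) ^ (-(β + 1)) ≤ pairForce α β (n * u) := by
  have hn0 : (0 : ℝ) < n := by exact_mod_cast (by omega)
  rw [pairForce_eq _ _ (mul_pos hn0 hu0)]
  have h1 := (h.rpow_le hu0 hu hn).trans h.half
  have h2 : (n : ℝ) ^ (-(β + 1)) ≤ ((n : ℝ) * u) ^ (-(β + 1)) :=
    Real.rpow_le_rpow_of_nonpos (by positivity) (by nlinarith) (by linarith [h.one_lt])
  have h3 : 0 < (n : ℝ) ^ (-(β + 1)) := by positivity
  nlinarith

/-- The diagonal dominance scheme: `i` is the bond's own pair, with a steep force, and `G` bounds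
the response of the farther pairs. -/
lemma sub_sum_le_sum_of_single {ι : Type*} [DecidableEq ι] {s : Finset ι} {F G : ι → ℝ} {i : ι}
    (hi : i ∈ s) {a : ℝ} (ha : a ≤ F i) (hG : 0 ≤ G i)
    (hF : ∀ j ∈ s, j ≠ i → -G j ≤ F j) : a - ∑ j ∈ s, G j ≤ ∑ j ∈ s, F j := by
  rw [← Finset.add_sum_erase s F hi, ← Finset.add_sum_erase s G hi]
  have : -∑ j ∈ s.erase i, G j ≤ ∑ j ∈ s.erase i, F j := by
    rw [← Finset.sum_neg_distrib]
    exact Finset.sum_le_sum fun j hj =>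
      hF j (Finset.mem_of_mem_erase hj) (Finset.ne_of_mem_erase hj)
  linarith

/-- The smallest bond length compatible with force balance. -/
noncomputable def minBond (α β : ℝ) : ℝ :=
  (1 / zeta β) ^ (1 / (α - β))

/-- The bond length of the infinite chain. -/
noncomputable def limitBond (α β : ℝ) : ℝ :=
  (zeta α / zeta β) ^ (1 / (α - β))

lemma rpow_one_div_rpow {x p : ℝ} (hx : 0 ≤ x) (hp : p ≠ 0) : (x ^ (1 / p)) ^ p = x := by
  rw [← Real.rpow_mul hx, one_div_mul_cancel hp, Real.rpow_one]

lemma minBond_pos (hβ : 1 < β) : 0 < minBond α β := by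
  have := one_le_zeta hβ
  unfold minBond
  positivity

lemma minBond_rpow (hβ : 1 < β) (hαβ : β < α) : minBond α β ^ (-(α - β)) = zeta β := by
  have := one_le_zeta hβ
  rw [Real.rpow_neg (minBond_pos hβ).le, minBond, rpow_one_div_rpow (by positivity)
    (by linarith), one_div, inv_inv]

lemma minBond_le (hβ : 1 < β) (hαβ : β < α) {u : ℝ} (hu : 0 < u) (h : u ^ (-(α - β)) ≤ zeta β) :
    minBond α β ≤ u := by
  by_contra! hlt
  have := Real.rpow_lt_rpow_of_neg hu hlt (show -(α - β) < 0 by linarith)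
  rw [minBond_rpow hβ hαβ] at this
  linarith

lemma limitBond_pos (hβ : 1 < β) (hαβ : β < α) : 0 < limitBond α β := by
  have := one_le_zeta hβ
  have := one_le_zeta (hβ.trans hαβ)
  unfold limitBond
  positivity

lemma limitBond_rpow (hβ : 1 < β) (hαβ : β < α) :
    limitBond α β ^ (α - β) = zeta α / zeta β := by
  have := one_le_zeta hβ
  have := one_le_zeta (hβ.trans hαβ)
  rw [limitBond, rpow_one_div_rpow (by positivity) (by linarith)]

/-- Since `ζ(α) ≥ 1`, the limit bond qualifies as the length `u` of the `StiffExponent` estimates.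
-/
lemma limitBond_rpow_neg_le (hβ : 1 < β) (hαβ : β < α) :
    limitBond α β ^ (-(α - β)) ≤ zeta β := by
  have h1 := one_le_zeta hβ
  have h2 := one_le_zeta (hβ.trans hαβ)
  rw [Real.rpow_neg (limitBond_pos hβ hαβ).le, limitBond_rpow hβ hαβ, inv_div]
  exact div_le_self (by linarith) h2

lemma limitBond_le_one (hβ : 1 < β) (hαβ : β < α) : limitBond α β ≤ 1 := by
  have h1 := one_le_zeta hβ
  have h2 := one_le_zeta (hβ.trans hαβ)
  refine Real.rpow_le_one (by positivity) ?_ (one_div_nonneg.2 (by linarith))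
  rw [div_le_one (by linarith)]
  exact zeta_le_zeta hβ hαβ.le

/-- The force on a bond of the infinite chain with bond length `m`. -/
lemma hasSum_pairForce (hβ : 1 < β) (hαβ : β < α) {m : ℝ} (hm : 0 < m) :
    HasSum (fun n : ℕ => ((n + 1 : ℕ) : ℝ) * pairForce α β ((n + 1 : ℕ) * m))
      (m ^ (-(α + 1)) * (zeta β * (m ^ (α - β) - limitBond α β ^ (α - β)))) := by
  have h1 := ((hasSum_zeta hβ).mul_left (m ^ (-(β + 1)))).sub
    ((hasSum_zeta (hβ.trans hαβ)).mul_left (m ^ (-(α + 1))))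
  have hz := one_le_zeta hβ
  have h2 : m ^ (-(α + 1)) * (zeta β * (m ^ (α - β) - limitBond α β ^ (α - β))) =
      m ^ (-(β + 1)) * zeta β - m ^ (-(α + 1)) * zeta α := by
    rw [limitBond_rpow hβ hαβ, show -(β + 1) = -(α + 1) + (α - β) by ring, Real.rpow_add hm]
    field_simp
  have h3 : (fun n : ℕ => ((n + 1 : ℕ) : ℝ) * pairForce α β ((n + 1 : ℕ) * m)) =
      fun n : ℕ => m ^ (-(β + 1)) * ((n + 1 : ℕ) : ℝ) ^ (-β) -
        m ^ (-(α + 1)) * ((n + 1 : ℕ) : ℝ) ^ (-α) := by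
    funext n
    have hn : (0 : ℝ) < ((n + 1 : ℕ) : ℝ) := by positivity
    have e : ∀ s : ℝ, ((n + 1 : ℕ) : ℝ) * (((n + 1 : ℕ) : ℝ) * m) ^ (-(s + 1)) =
        m ^ (-(s + 1)) * ((n + 1 : ℕ) : ℝ) ^ (-s) := by
      intro s
      rw [Real.mul_rpow hn.le hm.le, neg_add, Real.rpow_add hn, Real.rpow_neg_one]
      field_simp
    rw [pairForce, mul_sub, e, e]
  rw [h2, h3]
  exact h1

variable {N : ℕ} {y z : ℕ → ℝ}

lemma Balanced.minBond_le (h : StiffExponent α β) (hy : Balanced α β N y) {p : ℕ}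
    (hp : p + 1 < N) : minBond α β ≤ y (p + 1) - y p :=
  MagneticChain.minBond_le h.one_lt h.lt (sub_pos.2 (hy.lt_succ p hp))
    (hy.bond_rpow_le_zeta h.one_lt h.lt hp)

lemma minBond_le_one (hβ : 1 < β) (hαβ : β < α) : minBond α β ≤ 1 :=
  (minBond_le hβ hαβ (limitBond_pos hβ hαβ) (limitBond_rpow_neg_le hβ hαβ)).trans
    (limitBond_le_one hβ hαβ)

/-- Discrete maximum principle: where `y` exceeds `z` most, by `d`, the bond's own force difference
is at least `(α - β) d`, and a pair at distance `n`, stretched by at most `n d`, offsets too little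
of it. -/
lemma Balanced.bond_le_bond_of_max (h : StiffExponent α β) (hy : Balanced α β N y)
    (hz : Balanced α β N z) {p : ℕ} (hp : p + 1 < N)
    (hmax : ∀ l, l + 1 < N →
      |(y (l + 1) - y l) - (z (l + 1) - z l)| ≤ (y (p + 1) - y p) - (z (p + 1) - z p)) :
    y (p + 1) - y p ≤ z (p + 1) - z p := by
  have hβ := h.one_lt
  have hζ := one_le_zeta hβ
  set d := (y (p + 1) - y p) - (z (p + 1) - z p) with hd
  have hd0 : 0 ≤ d := (abs_nonneg _).trans (hmax p hp)
  have key := sub_sum_le_sum_of_single (self_mem_bondBox hp)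
    (F := fun q => pairForce α β (y q.2 - y q.1) - pairForce α β (z q.2 - z q.1))
    (G := fun q => (β + 1) * zeta β * d * ((q.2 - q.1 : ℕ) : ℝ) ^ (-(β + 1)))
    (mul_sub_le_pairForce_sub hβ h.lt (sub_pos.2 (hz.lt_succ p hp)) (by linarith)
      (hy.bond_le_one h.lt hp)) (by positivity) (fun q hq hne => ?_)
  · rw [Finset.sum_sub_distrib, hy.force p hp, hz.force p hp, sub_zero, ← Finset.mul_sum] at key
    have h1 := mul_le_mul_of_nonneg_left (sum_bondBox_rpow_le hβ hp)
      (show 0 ≤ (β + 1) * zeta β * d by positivity)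
    have h2 : (β + 1) * zeta β * zeta β ≤ (β + 1) * zeta β * convConst β :=
      mul_le_mul_of_nonneg_left (zeta_le_convConst hβ) (by positivity)
    have h3 := h.stiff
    have : d ≤ 0 := by
      rw [← hd] at key
      nlinarith
    linarith
  · have hq' := mem_bondBox.1 hq
    have hn := two_le_of_mem_bondBox hq hne
    have hn0 : (0 : ℝ) < ((q.2 - q.1 : ℕ) : ℝ) := by exact_mod_cast (by omega)
    have hY := mul_le_sub_of_le_bonds (fun p hp => hy.minBond_le h hp)
      (show q.1 ≤ q.2 by omega) hq'.2.2
    have hZ := mul_le_sub_of_le_bonds (fun p hp => hz.minBond_le h hp)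
      (show q.1 ≤ q.2 by omega) hq'.2.2
    have hdiff : |(y q.2 - y q.1) - (z q.2 - z q.1)| ≤ ((q.2 - q.1 : ℕ) : ℝ) * d := by
      rw [← Finset.sum_Ico_sub y (by omega), ← Finset.sum_Ico_sub z (by omega),
        ← Finset.sum_sub_distrib, ← Nat.card_Ico, ← nsmul_eq_mul]
      refine (Finset.abs_sum_le_sum_abs _ _).trans (Finset.sum_le_card_nsmul _ _ _ fun l hl => ?_)
      rw [Finset.mem_Ico] at hl
      exact hmax l (by omega)
    have hpow : ((q.2 - q.1 : ℕ) : ℝ) ^ (-(β + 1)) =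
        ((q.2 - q.1 : ℕ) : ℝ) ^ (-(β + 2)) * ((q.2 - q.1 : ℕ) : ℝ) := by
      rw [← Real.rpow_add_one hn0.ne']
      ring_nf
    have hM : 0 ≤ (β + 1) * zeta β * ((q.2 - q.1 : ℕ) : ℝ) ^ (-(β + 2)) := by positivity
    have hG := mul_le_mul_of_nonneg_left hdiff hM
    have hu0 := minBond_pos (α := α) hβ
    have hu1 := minBond_le_one hβ h.lt
    have hu := (minBond_rpow hβ h.lt).le
    rw [hpow]
    -- If the pair is wider in `y`, its force drops by a bounded amount; otherwise monotonicity
    -- already gives the favourable sign.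
    rcases le_total (z q.2 - z q.1) (y q.2 - y q.1) with hle | hle
    · have := (h.pairForce_sub_bounds hu0 hu1 hu hn hZ hle).1
      rw [abs_of_nonneg (by linarith)] at hG
      linarith
    · have := (h.pairForce_sub_bounds hu0 hu1 hu hn hY hle).2
      have hG0 : 0 ≤ (β + 1) * zeta β * ((q.2 - q.1 : ℕ) : ℝ) ^ (-(β + 2)) *
        (((q.2 - q.1 : ℕ) : ℝ) * d) := by positivity
      linarith

/-- Force balance determines the bond lengths. -/
theorem Balanced.bond_eq (h : StiffExponent α β) (hy : Balanced α β N y)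
    (hz : Balanced α β N z) {p : ℕ} (hp : p + 1 < N) :
    y (p + 1) - y p = z (p + 1) - z p := by
  -- The bond of largest absolute difference; the roles of `y` and `z` are exchanged according to
  -- its sign.
  obtain ⟨p₀, hp₀, hmin⟩ := exists_min_bond
    (fun l => -|(y (l + 1) - y l) - (z (l + 1) - z l)|) hp
  have hmax : ∀ l, l + 1 < N → |(y (l + 1) - y l) - (z (l + 1) - z l)| ≤
      |(y (p₀ + 1) - y p₀) - (z (p₀ + 1) - z p₀)| := fun l hl => neg_le_neg_iff.1 (hmin l hl)
  have h0 : |(y (p₀ + 1) - y p₀) - (z (p₀ + 1) - z p₀)| ≤ 0 := by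
    rcases le_total (z (p₀ + 1) - z p₀) (y (p₀ + 1) - y p₀) with hle | hle
    · rw [abs_of_nonneg (sub_nonneg.2 hle)] at hmax ⊢
      exact sub_nonpos.2 (hy.bond_le_bond_of_max h hz hp₀ hmax)
    · rw [abs_sub_comm, abs_of_nonneg (sub_nonneg.2 hle)] at hmax ⊢
      exact sub_nonpos.2 (hz.bond_le_bond_of_max h hy hp₀ fun l hl => by
        rw [abs_sub_comm]
        exact hmax l hl)
  exact sub_eq_zero.1 (abs_nonpos_iff.1 ((hmax p hp).trans h0))

end Stiff

/-! ### Deviation of the bonds from the limit bond -/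

section BondEstimates

variable {α β : ℝ} {N : ℕ} {y : ℕ → ℝ}

/-- The shortest bond feels the attraction missing beyond the ends of the chain. -/
lemma Balanced.tail_le_min_bond (h : StiffExponent α β) (hy : Balanced α β N y) {p : ℕ}
    (hp : p + 1 < N) (hmin : ∀ l, l + 1 < N → y (p + 1) - y p ≤ y (l + 1) - y l) :
    1 / 2 * (2 ^ (-β) * (N : ℝ) ^ (1 - β)) ≤ (y (p + 1) - y p) ^ (-(α + 1)) *
      (zeta β * ((y (p + 1) - y p) ^ (α - β) - limitBond α β ^ (α - β))) := by
  have hβ := h.one_lt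
  set m := y (p + 1) - y p with hm
  have hm0 : 0 < m := sub_pos.2 (hy.lt_succ p hp)
  have hm1 : m ≤ 1 := hy.bond_le_one h.lt hp
  have hmζ : m ^ (-(α - β)) ≤ zeta β := hy.bond_rpow_le_zeta hβ h.lt hp
  have hfar : ∀ n : ℕ, 2 ≤ n → 1 / 2 * (n : ℝ) ^ (-(β + 1)) ≤ pairForce α β (n * m) :=
    fun n hn => h.le_pairForce hm0 hm1 hmζ hn
  have hnn : ∀ n : ℕ, 2 ≤ n → 0 ≤ pairForce α β (n * m) := fun n hn =>
    le_trans (by positivity) (hfar n hn)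
  -- Shrinking each distance to `n m` leaves the bond's own pair unchanged and raises the decreasing
  -- force of all others.
  have h1 : 0 ≤ ∑ q ∈ bondBox p N, pairForce α β ((q.2 - q.1 : ℕ) * m) := by
    rw [← hy.force p hp]
    refine Finset.sum_le_sum fun q hq => ?_
    rcases eq_or_ne q (p, p + 1) with rfl | hne
    · simp [hm]
    · have hq' := mem_bondBox.1 hq
      have := (h.pairForce_sub_bounds hm0 hm1 hmζ (two_le_of_mem_bondBox hq hne) le_rfl
        (mul_le_sub_of_le_bonds hmin (by omega) hq'.2.2)).2
      linarith
  have h2 := h1.trans (sum_bondBox_dist_le hp (F := fun n : ℕ => pairForce α β (n * m)) hnn)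
  -- Cutting the series at `2 N` leaves, beyond the finite chain, the window `[N, 2 N)`, which
  -- yields the order `N^(1-β)`; the terms cut off are nonnegative.
  have h3 : ∑ n ∈ Finset.Ico 1 (2 * N), (n : ℝ) * pairForce α β (n * m) ≤
      m ^ (-(α + 1)) * (zeta β * (m ^ (α - β) - limitBond α β ^ (α - β))) := by
    obtain ⟨M, hM⟩ : ∃ M, 2 * N = M + 1 := ⟨2 * N - 1, by omega⟩
    rw [hM, sum_Ico_one_eq fun n : ℕ => (n : ℝ) * pairForce α β (n * m)]
    refine sum_le_hasSum _ (fun n hn => ?_) (hasSum_pairForce hβ h.lt hm0)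
    rw [Finset.mem_range] at hn
    exact mul_nonneg (by positivity) (hnn _ (by omega))
  rw [← Finset.sum_Ico_consecutive _ (show 1 ≤ N by omega) (show N ≤ 2 * N by omega)] at h3
  have h4 : 1 / 2 * ∑ n ∈ Finset.Ico N (2 * N), (n : ℝ) ^ (-β) ≤
      ∑ n ∈ Finset.Ico N (2 * N), (n : ℝ) * pairForce α β (n * m) := by
    rw [Finset.mul_sum]
    refine Finset.sum_le_sum fun n hn => ?_
    rw [Finset.mem_Ico] at hn
    have hn0 : (0 : ℝ) < n := by exact_mod_cast (by omega)
    have := mul_le_mul_of_nonneg_left (hfar n (by omega)) hn0.le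
    refine le_trans (le_of_eq ?_) this
    rw [neg_add, Real.rpow_add hn0, Real.rpow_neg_one]
    field_simp
  have h5 := le_tail_sum (show 0 < β by linarith) (show 1 ≤ N by omega)
  linarith

/-- The bonds of a finite chain are longer than those of the infinite one. -/
lemma exists_limitBond_add_le (h : StiffExponent α β) : ∃ c : ℝ, 0 < c ∧
    ∀ (N : ℕ) (y : ℕ → ℝ), Balanced α β N y → ∀ p, p + 1 < N →
      limitBond α β + c * (N : ℝ) ^ (1 - β) ≤ y (p + 1) - y p := by
  have hβ := h.one_lt
  have hζ := one_le_zeta hβ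
  have hu0 := minBond_pos (α := α) hβ
  have hαβ : 1 ≤ α - β := by linarith [h.two_mul_le]
  -- A Lipschitz constant turning the force surplus of the infinite chain into the surplus of bond
  -- length `m - s`.
  set D := minBond α β ^ (-(α + 1)) * (zeta β * (α - β)) with hD
  have hD0 : 0 < D := by positivity
  refine ⟨1 / 2 * 2 ^ (-β) / D, by positivity, fun N y hy p hp => ?_⟩
  obtain ⟨p₀, hp₀, hmin⟩ := exists_min_bond (fun p => y (p + 1) - y p) hp
  refine le_trans ?_ (hmin p hp)
  have h1 := hy.tail_le_min_bond h hp₀ hmin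
  have hum := hy.minBond_le h hp₀
  have hm1 := hy.bond_le_one h.lt hp₀
  set m := y (p₀ + 1) - y p₀
  have hm0 : 0 < m := hu0.trans_le hum
  have hN : (0 : ℝ) < N := by exact_mod_cast (by omega)
  set s := limitBond α β
  have hs0 : 0 < s := limitBond_pos hβ h.lt
  have hpos : 0 < m ^ (-(α + 1)) := by positivity
  have hNp : 0 < (N : ℝ) ^ (1 - β) := by positivity
  have hlt : 0 < m ^ (α - β) - s ^ (α - β) := by
    have h2 : 0 < m ^ (-(α + 1)) * (zeta β * (m ^ (α - β) - s ^ (α - β))) :=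
      lt_of_lt_of_le (by positivity) h1
    have h3 := (mul_pos_iff_of_pos_left hpos).1 h2
    exact (mul_pos_iff_of_pos_left (by linarith)).1 h3
  have hsm : s < m := by
    by_contra! hle
    have := Real.rpow_le_rpow hm0.le hle (show 0 ≤ α - β by linarith)
    linarith
  -- Bernoulli's inequality for `(s / m)^(α-β)`, with `m^(α-β) ≤ m` because `m ≤ 1`.
  have hbern : m ^ (α - β) - s ^ (α - β) ≤ (α - β) * (m - s) := by
    have h2 := one_add_mul_self_le_rpow_one_add (s := s / m - 1)
      (by have : 0 < s / m := by positivity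
          linarith) hαβ
    rw [add_sub_cancel, Real.div_rpow hs0.le hm0.le, le_div_iff₀ (by positivity)] at h2
    have h3 : m ^ (α - β) ≤ m := by
      simpa using Real.rpow_le_rpow_of_exponent_ge hm0 hm1 hαβ
    have h4 : m ^ (α - β) * (m - s) / m ≤ m - s := by
      rw [div_le_iff₀ hm0, mul_comm]
      exact mul_le_mul_of_nonneg_left h3 (by linarith)
    have h5 : (1 + (α - β) * (s / m - 1)) * m ^ (α - β) =
        m ^ (α - β) - (α - β) * (m ^ (α - β) * (m - s) / m) := by
      field_simp
      ring
    rw [h5] at h2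
    nlinarith
  have hpow : m ^ (-(α + 1)) ≤ minBond α β ^ (-(α + 1)) :=
    Real.rpow_le_rpow_of_nonpos hu0 hum (by linarith)
  have h6 : 1 / 2 * (2 ^ (-β) * (N : ℝ) ^ (1 - β)) ≤ D * (m - s) := by
    refine h1.trans ?_
    calc _ ≤ minBond α β ^ (-(α + 1)) * (zeta β * ((α - β) * (m - s))) := by gcongr
      _ = _ := by rw [hD]; ring
  have h7 : 1 / 2 * 2 ^ (-β) / D * (N : ℝ) ^ (1 - β) ≤ m - s := by
    rw [div_mul_eq_mul_div, div_le_iff₀ hD0]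
    linarith
  linarith

/-- The order of magnitude of the influence of the two ends at the bond `l`. -/
noncomputable def endEffect (β : ℝ) (N l : ℕ) : ℝ :=
  ((l + 1 : ℕ) : ℝ) ^ (1 - β) + ((N - 1 - l : ℕ) : ℝ) ^ (1 - β)

lemma endEffect_pos {l : ℕ} : 0 < endEffect β N l := by
  unfold endEffect
  positivity

/-- Either the window reaches at least half way to the end, where 1 is the trivial bound, or `l ≥ k
/ 2`. -/
lemma rpow_le_of_near (hβ : 1 < β) {k l n : ℕ} (hk : 1 ≤ k) (hl : 1 ≤ l) (hkl : k ≤ l + n) :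
    (l : ℝ) ^ (1 - β) ≤ 2 ^ (β - 1) * (k : ℝ) ^ (1 - β) + if k < 2 * n then 1 else 0 := by
  have hk0 : (0 : ℝ) < k := by exact_mod_cast hk
  have hl1 : (1 : ℝ) ≤ l := by exact_mod_cast hl
  split_ifs with h
  · have h1 : (l : ℝ) ^ (1 - β) ≤ 1 := Real.rpow_le_one_of_one_le_of_nonpos hl1 (by linarith)
    have h2 : 0 ≤ (2 : ℝ) ^ (β - 1) * (k : ℝ) ^ (1 - β) := by positivity
    linarith
  · have h1 : (k : ℝ) / 2 ≤ l := by
      have : (k : ℝ) ≤ 2 * l := by exact_mod_cast (by omega)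
      linarith
    have h2 := Real.rpow_le_rpow_of_nonpos (by positivity) h1 (show 1 - β ≤ 0 by linarith)
    rw [div_eq_mul_inv, mul_comm, Real.mul_rpow (by norm_num) hk0.le,
      Real.inv_rpow (by norm_num), ← Real.rpow_neg (by norm_num), neg_sub] at h2
    linarith

/-- Only distances above `k / 2` contribute, so this is a tail of `ζ(β)`. -/
lemma sum_bondBox_far_le (hβ : 1 < β) {p : ℕ} (hp : p + 1 < N) {k : ℕ} (hk : 1 ≤ k) :
    ∑ q ∈ bondBox p N, ((q.2 - q.1 : ℕ) : ℝ) ^ (-(β + 1)) *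
        (if k < 2 * (q.2 - q.1) then (1 : ℝ) else 0) ≤
      2 ^ (β - 1) * (1 + 1 / (β - 1)) * (k : ℝ) ^ (1 - β) := by
  have hk0 : (0 : ℝ) < k := by exact_mod_cast hk
  have h1 := sum_bondBox_dist_le hp
    (F := fun n : ℕ => (n : ℝ) ^ (-(β + 1)) * (if k < 2 * n then (1 : ℝ) else 0))
    (fun n _ => by positivity)
  refine h1.trans ?_
  have h2 : ∑ n ∈ Finset.Ico 1 N, (n : ℝ) * ((n : ℝ) ^ (-(β + 1)) *
      (if k < 2 * n then (1 : ℝ) else 0)) = ∑ n ∈ Finset.Ico (k / 2 + 1) N, (n : ℝ) ^ (-β) := by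
    have : Finset.Ico (k / 2 + 1) N = (Finset.Ico 1 N).filter fun n => k < 2 * n := by
      ext n
      simp only [Finset.mem_filter, Finset.mem_Ico]
      omega
    rw [this, Finset.sum_filter]
    refine Finset.sum_congr rfl fun n hn => ?_
    have hn0 : (0 : ℝ) < n := by exact_mod_cast (Finset.mem_Ico.1 hn).1
    split_ifs
    · rw [neg_add, Real.rpow_add hn0, Real.rpow_neg_one]
      field_simp
    · simp
  rw [h2]
  refine (tail_sum_le hβ (by omega) N).trans ?_
  have h3 : (k : ℝ) / 2 ≤ ((k / 2 + 1 : ℕ) : ℝ) := by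
    have : (k : ℝ) ≤ 2 * ((k / 2 + 1 : ℕ) : ℝ) := by exact_mod_cast (by omega)
    linarith
  have h4 := Real.rpow_le_rpow_of_nonpos (by positivity) h3 (show 1 - β ≤ 0 by linarith)
  rw [div_eq_mul_inv, mul_comm, Real.mul_rpow (by norm_num) hk0.le,
    Real.inv_rpow (by norm_num), ← Real.rpow_neg (by norm_num), neg_sub] at h4
  have h5 : 0 ≤ 1 + 1 / (β - 1) := by
    have : 0 ≤ 1 / (β - 1) := one_div_nonneg.2 (by linarith)
    linarith
  have := mul_le_mul_of_nonneg_left h4 h5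
  linarith

/-- The end effect is reproduced by discrete convolution with the interaction. -/
lemma sum_bondBox_endEffect_le (hβ : 1 < β) {p : ℕ} (hp : p + 1 < N) :
    ∑ q ∈ bondBox p N, ((q.2 - q.1 : ℕ) : ℝ) ^ (-(β + 2)) *
        ∑ l ∈ Finset.Ico q.1 q.2, endEffect β N l ≤ convConst β * endEffect β N p := by
  have h1 : ∀ q ∈ bondBox p N, ((q.2 - q.1 : ℕ) : ℝ) ^ (-(β + 2)) *
      ∑ l ∈ Finset.Ico q.1 q.2, endEffect β N l ≤
      2 ^ (β - 1) * endEffect β N p * ((q.2 - q.1 : ℕ) : ℝ) ^ (-(β + 1)) +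
      (((q.2 - q.1 : ℕ) : ℝ) ^ (-(β + 1)) * (if p + 1 < 2 * (q.2 - q.1) then (1 : ℝ) else 0) +
      ((q.2 - q.1 : ℕ) : ℝ) ^ (-(β + 1)) *
        (if N - 1 - p < 2 * (q.2 - q.1) then (1 : ℝ) else 0)) := by
    intro q hq
    rw [mem_bondBox] at hq
    have hn0 : (0 : ℝ) < ((q.2 - q.1 : ℕ) : ℝ) := by exact_mod_cast (by omega)
    have h2 : ∑ l ∈ Finset.Ico q.1 q.2, endEffect β N l ≤ ((q.2 - q.1 : ℕ) : ℝ) *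
        (2 ^ (β - 1) * endEffect β N p + ((if p + 1 < 2 * (q.2 - q.1) then (1 : ℝ) else 0) +
          (if N - 1 - p < 2 * (q.2 - q.1) then (1 : ℝ) else 0))) := by
      rw [← Nat.card_Ico, ← nsmul_eq_mul]
      refine Finset.sum_le_card_nsmul _ _ _ fun l hl => ?_
      rw [Finset.mem_Ico] at hl
      rw [Nat.card_Ico]
      have a1 := rpow_le_of_near hβ (show 1 ≤ p + 1 by omega) (show 1 ≤ l + 1 by omega)
        (show p + 1 ≤ l + 1 + (q.2 - q.1) by omega)
      have a2 := rpow_le_of_near hβ (show 1 ≤ N - 1 - p by omega) (show 1 ≤ N - 1 - l by omega)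
        (show N - 1 - p ≤ N - 1 - l + (q.2 - q.1) by omega)
      unfold endEffect
      linarith
    have h3 : ((q.2 - q.1 : ℕ) : ℝ) ^ (-(β + 1)) =
        ((q.2 - q.1 : ℕ) : ℝ) ^ (-(β + 2)) * ((q.2 - q.1 : ℕ) : ℝ) := by
      rw [← Real.rpow_add_one hn0.ne']
      ring_nf
    refine (mul_le_mul_of_nonneg_left h2 (by positivity)).trans (le_of_eq ?_)
    rw [h3]
    ring
  refine (Finset.sum_le_sum h1).trans ?_
  rw [Finset.sum_add_distrib, Finset.sum_add_distrib, ← Finset.mul_sum]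
  have b1 := sum_bondBox_far_le hβ hp (show 1 ≤ p + 1 by omega)
  have b2 := sum_bondBox_far_le hβ hp (show 1 ≤ N - 1 - p by omega)
  have he := endEffect_pos (β := β) (N := N) (l := p)
  have b3 := mul_le_mul_of_nonneg_left (sum_bondBox_rpow_le hβ hp)
    (show 0 ≤ 2 ^ (β - 1) * endEffect β N p by positivity)
  have b4 : convConst β * endEffect β N p = 2 ^ (β - 1) * endEffect β N p * zeta β +
      (2 ^ (β - 1) * (1 + 1 / (β - 1)) * ((p + 1 : ℕ) : ℝ) ^ (1 - β) +
      2 ^ (β - 1) * (1 + 1 / (β - 1)) * ((N - 1 - p : ℕ) : ℝ) ^ (1 - β)) := by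
    unfold convConst endEffect
    ring
  rw [b4]
  exact add_le_add b3 (add_le_add b1 b2)

/-- The equidistant chain is balanced up to the end effect. -/
lemma neg_endEffect_le_sum_limitBond (h : StiffExponent α β) {p : ℕ} (hp : p + 1 < N) :
    -(zeta β * (1 + 1 / (β - 1)) * endEffect β N p) ≤
      ∑ q ∈ bondBox p N, pairForce α β ((q.2 - q.1 : ℕ) * limitBond α β) := by
  have hβ := h.one_lt
  have hζ := one_le_zeta hβ
  set s := limitBond α β
  have hs0 : 0 < s := limitBond_pos hβ h.lt
  have hs1 : s ≤ 1 := limitBond_le_one hβ h.lt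
  have hs : s ^ (-(α - β)) ≤ zeta β := limitBond_rpow_neg_le hβ h.lt
  have hC : 0 ≤ 1 + 1 / (β - 1) := by
    have : 0 ≤ 1 / (β - 1) := one_div_nonneg.2 (by linarith)
    linarith
  have htail : ∀ a M b : ℕ, 1 ≤ b → b ≤ a → ∑ n ∈ Finset.Ico a M, (n : ℝ) * pairForce α β (n * s) ≤
      zeta β * (1 + 1 / (β - 1)) * (b : ℝ) ^ (1 - β) := by
    intro a M b hb hba
    have hb0 : (0 : ℝ) < b := by exact_mod_cast hb
    have h1 : ∑ n ∈ Finset.Ico a M, (n : ℝ) * pairForce α β (n * s) ≤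
        zeta β * ∑ n ∈ Finset.Ico a M, (n : ℝ) ^ (-β) := by
      rw [Finset.mul_sum]
      refine Finset.sum_le_sum fun n hn => ?_
      rw [Finset.mem_Ico] at hn
      have hn0 : (0 : ℝ) < n := by exact_mod_cast (by omega)
      have h2 := mul_le_mul_of_nonneg_left (pairForce_le (α := α) (β := β) (mul_pos hn0 hs0)) hn0.le
      refine h2.trans ?_
      rw [Real.mul_rpow hn0.le hs0.le]
      have h3 := h.rpow_neg_le_zeta hs0 hs1 hs (show β + 1 ≤ β + 2 by linarith)
      have h4 : (n : ℝ) * ((n : ℝ) ^ (-(β + 1)) * s ^ (-(β + 1))) =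
          s ^ (-(β + 1)) * (n : ℝ) ^ (-β) := by
        rw [neg_add, Real.rpow_add hn0, Real.rpow_neg_one]
        field_simp
      rw [h4]
      gcongr
    have h5 := tail_sum_le hβ (show 1 ≤ a by omega) M
    have h6 : (a : ℝ) ^ (1 - β) ≤ (b : ℝ) ^ (1 - β) :=
      Real.rpow_le_rpow_of_nonpos hb0 (by exact_mod_cast hba) (by linarith)
    calc _ ≤ _ := h1
      _ ≤ zeta β * ((1 + 1 / (β - 1)) * (b : ℝ) ^ (1 - β)) := by gcongr; exact h5.trans (by gcongr)
      _ = _ := by ring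
  -- The infinite chain with the limit bond is in exact balance, so its partial sums tend to 0; each
  -- of them is at most the finite sum plus the two tails cut off at the ends.
  have hlim := (hasSum_pairForce hβ h.lt hs0).tendsto_sum_nat
  rw [sub_self, mul_zero, mul_zero] at hlim
  have hnn : ∀ n : ℕ, 2 ≤ n → 0 ≤ pairForce α β (n * s) := fun n hn =>
    le_trans (by positivity) (h.le_pairForce hs0 hs1 hs hn)
  have := le_of_tendsto hlim (b := ∑ q ∈ bondBox p N, pairForce α β ((q.2 - q.1 : ℕ) * s) +
    zeta β * (1 + 1 / (β - 1)) * endEffect β N p) ?_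
  · linarith
  · filter_upwards [Filter.eventually_ge_atTop N] with M hM
    rw [← sum_Ico_one_eq fun n : ℕ => (n : ℝ) * pairForce α β (n * s)]
    have h1 := le_sum_bondBox_dist hp (F := fun n : ℕ => pairForce α β (n * s)) hnn
      (show N ≤ M + 1 by omega)
    have h2 := htail (p + 2) (M + 1) (p + 1) (by omega) (by omega)
    have h3 := htail (N - p) (M + 1) (N - 1 - p) (by omega) (by omega)
    unfold endEffect
    linarith

/-- The bonds approach those of the infinite chain away from the ends. -/
lemma Balanced.bond_le_limitBond_add (h : StiffExponent α β) (hy : Balanced α β N y)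
    (hlow : ∀ l, l + 1 < N → limitBond α β ≤ y (l + 1) - y l) {p : ℕ} (hp : p + 1 < N) :
    y (p + 1) - y p ≤ limitBond α β + zeta β * (1 + 1 / (β - 1)) * endEffect β N p := by
  have hβ := h.one_lt
  have hζ := one_le_zeta hβ
  set s := limitBond α β
  have hs0 : 0 < s := limitBond_pos hβ h.lt
  have hs1 : s ≤ 1 := limitBond_le_one hβ h.lt
  have hs : s ^ (-(α - β)) ≤ zeta β := limitBond_rpow_neg_le hβ h.lt
  -- The bond maximizing the deviation relative to the weight `endEffect`; the maximum principle is
  -- applied there against the equidistant chain.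
  obtain ⟨p₀, hp₀, hmin⟩ := exists_min_bond
    (fun l => -((y (l + 1) - y l - s) / endEffect β N l)) hp
  set R := (y (p₀ + 1) - y p₀ - s) / endEffect β N p₀ with hR
  have he₀ := endEffect_pos (β := β) (N := N) (l := p₀)
  have hR0 : 0 ≤ R := div_nonneg (sub_nonneg.2 (hlow _ hp₀)) he₀.le
  have hle : ∀ l, l + 1 < N → y (l + 1) - y l - s ≤ R * endEffect β N l := fun l hl =>
    (div_le_iff₀ endEffect_pos).1 (neg_le_neg_iff.1 (hmin l hl))
  have heq : y (p₀ + 1) - y p₀ - s = R * endEffect β N p₀ := by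
    rw [hR, div_mul_cancel₀ _ he₀.ne']
  suffices hRC : R ≤ zeta β * (1 + 1 / (β - 1)) by
    have := mul_le_mul_of_nonneg_right hRC (endEffect_pos (β := β) (N := N) (l := p)).le
    linarith [hle p hp]
  have key := sub_sum_le_sum_of_single (self_mem_bondBox hp₀)
    (F := fun q => pairForce α β (y q.2 - y q.1) - pairForce α β ((q.2 - q.1 : ℕ) * s))
    (G := fun q => (β + 1) * zeta β * R * (((q.2 - q.1 : ℕ) : ℝ) ^ (-(β + 2)) *
      ∑ l ∈ Finset.Ico q.1 q.2, endEffect β N l))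
    (a := (α - β) * (y (p₀ + 1) - y p₀ - s)) ?_ ?_ (fun q hq hne => ?_)
  · rw [Finset.sum_sub_distrib, hy.force p₀ hp₀, ← Finset.mul_sum, heq] at key
    have h1 := neg_endEffect_le_sum_limitBond h hp₀
    have h2 := mul_le_mul_of_nonneg_left (sum_bondBox_endEffect_le hβ hp₀)
      (show 0 ≤ (β + 1) * zeta β * R by positivity)
    have h3 : R * endEffect β N p₀ * (α - β - (β + 1) * zeta β * convConst β) ≤
        zeta β * (1 + 1 / (β - 1)) * endEffect β N p₀ := by linarith
    -- Stiffness absorbs the response of the far pairs and leaves a factor at least 1.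
    have h4 : R * endEffect β N p₀ * 1 ≤
        R * endEffect β N p₀ * (α - β - (β + 1) * zeta β * convConst β) :=
      mul_le_mul_of_nonneg_left (by linarith [h.stiff]) (by positivity)
    rw [mul_one] at h4
    exact le_of_mul_le_mul_right (h4.trans h3) he₀
  · have := mul_sub_le_pairForce_sub hβ h.lt hs0 (hlow p₀ hp₀) (hy.bond_le_one h.lt hp₀)
    simpa using this
  · have : 0 ≤ ∑ l ∈ Finset.Ico p₀ (p₀ + 1), endEffect β N l :=
      Finset.sum_nonneg fun l _ => endEffect_pos.le
    positivity
  · have hq' := mem_bondBox.1 hq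
    have hY := mul_le_sub_of_le_bonds hlow (show q.1 ≤ q.2 by omega) hq'.2.2
    have h1 := (h.pairForce_sub_bounds hs0 hs1 hs (two_le_of_mem_bondBox hq hne) le_rfl hY).1
    have h2 : y q.2 - y q.1 - ((q.2 - q.1 : ℕ) : ℝ) * s ≤
        R * ∑ l ∈ Finset.Ico q.1 q.2, endEffect β N l := by
      rw [← Finset.sum_Ico_sub y (by omega), ← Nat.card_Ico, ← nsmul_eq_mul, ← Finset.sum_const,
        ← Finset.sum_sub_distrib, Finset.mul_sum]
      refine Finset.sum_le_sum fun l hl => hle l ?_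
      rw [Finset.mem_Ico] at hl
      omega
    have h3 := mul_le_mul_of_nonneg_left h2
      (show 0 ≤ (β + 1) * zeta β * ((q.2 - q.1 : ℕ) : ℝ) ^ (-(β + 2)) by positivity)
    linarith

end BondEstimates

/-! ### First variation of the energy at a spear -/

/-- The derivative of the energy of two aligned particles with respect to their distance. -/
noncomputable def axialForce (A B α β r : ℝ) : ℝ :=
  β * B * r ^ (-(β + 1)) - α * A * r ^ (-(α + 1))

lemma inner_axis_left (ρ : ℝ) (w : E3) : inner ℝ (EuclideanSpace.single 0 ρ : E3) w = ρ * w 0 := by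
  simp [EuclideanSpace.inner_single_left]

lemma inner_axis_right (ρ : ℝ) (w : E3) : inner ℝ w (EuclideanSpace.single 0 ρ : E3) = ρ * w 0 := by
  rw [real_inner_comm, inner_axis_left]

lemma hasDerivAt_norm_of_axis {r : ℝ → E3} {w : E3} {ρ : ℝ} (hρ : 0 < ρ) (hr : HasDerivAt r w 0)
    (h0 : r 0 = EuclideanSpace.single 0 ρ) : HasDerivAt (fun t => ‖r t‖) (w 0) 0 := by
  have hn : ‖r 0‖ = ρ := by simp [h0, abs_of_pos hρ]
  have h1 := hr.norm_sq.sqrt (by rw [hn]; positivity)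
  simp only [Real.sqrt_sq (norm_nonneg _)] at h1
  refine h1.congr_deriv ?_
  rw [hn, h0, inner_axis_left]
  field_simp

/-- Differentiate `‖m‖² = 1`. -/
lemma spin_deriv_axis {m : ℝ → S2} {μ : E3} (hm : HasDerivAt (fun t => (m t : E3)) μ 0)
    (h0 : m 0 = axisSpin) : μ 0 = 0 := by
  have h1 := hm.norm_sq
  have h2 : (fun t => ‖(m t : E3)‖ ^ 2) = fun _ => 1 := by
    funext t
    simp
  rw [h2, h0] at h1
  have h3 := h1.unique (hasDerivAt_const (0 : ℝ) (1 : ℝ))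
  rw [axisSpin, inner_axis_left] at h3
  linarith

lemma hasDerivAt_inner_spins {m n : ℝ → S2} {μ ν : E3}
    (hm : HasDerivAt (fun t => (m t : E3)) μ 0) (hn : HasDerivAt (fun t => (n t : E3)) ν 0)
    (hm0 : m 0 = axisSpin) (hn0 : n 0 = axisSpin) :
    HasDerivAt (fun t => inner ℝ (m t : E3) (n t : E3)) 0 0 := by
  refine (hm.inner ℝ hn).congr_deriv ?_
  rw [hm0, hn0, axisSpin, inner_axis_left, inner_axis_right, spin_deriv_axis hm hm0,
    spin_deriv_axis hn hn0]
  simp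

lemma hasDerivAt_inner_spin_axis {m : ℝ → S2} {r : ℝ → E3} {μ w : E3} {ρ : ℝ}
    (hm : HasDerivAt (fun t => (m t : E3)) μ 0) (hm0 : m 0 = axisSpin)
    (hr : HasDerivAt r w 0) (h0 : r 0 = EuclideanSpace.single 0 ρ) :
    HasDerivAt (fun t => inner ℝ (m t : E3) (r t)) (w 0) 0 := by
  refine (hm.inner ℝ hr).congr_deriv ?_
  rw [hm0, h0, axisSpin, inner_axis_left, inner_axis_right, spin_deriv_axis hm hm0]
  simp

lemma single_sub_single (x y : ℝ) : (EuclideanSpace.single 0 x : E3) - EuclideanSpace.single 0 y =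
    EuclideanSpace.single 0 (x - y) := by
  ext i
  fin_cases i <;> simp

/-- Only the axial velocities enter the first variation of the energy of an aligned pair. -/
lemma hasDerivAt_pair (A B B₀ α β : ℝ) {a b : ℝ → E3 × S2} {x x' : ℝ} (hx : x' < x)
    (ha0 : a 0 = (EuclideanSpace.single 0 x, axisSpin))
    (hb0 : b 0 = (EuclideanSpace.single 0 x', axisSpin))
    (ha : DifferentiableAt ℝ (fun t => (a t).1) 0) (hb : DifferentiableAt ℝ (fun t => (b t).1) 0)
    (hma : DifferentiableAt ℝ (fun t => ((a t).2 : E3)) 0)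
    (hmb : DifferentiableAt ℝ (fun t => ((b t).2 : E3)) 0) :
    HasDerivAt (fun t => dipolarPair B B₀ β (a t) (b t) + repulsivePair A α (a t) (b t))
      (axialForce A B α β (x - x') *
        (deriv (fun t => (a t).1) 0 0 - deriv (fun t => (b t).1) 0 0)) 0 := by
  have hρ : 0 < x - x' := sub_pos.2 hx
  set ρ := x - x' with hρdef
  have hr := ha.hasDerivAt.sub hb.hasDerivAt
  have hr' : HasDerivAt (fun t => (a t).1 - (b t).1)
      (deriv (fun t => (a t).1) 0 - deriv (fun t => (b t).1) 0) 0 := hr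
  have hr0 : (a 0).1 - (b 0).1 = EuclideanSpace.single 0 ρ := by
    rw [ha0, hb0, single_sub_single]
  have hma0 : (a 0).2 = axisSpin := by rw [ha0]
  have hmb0 : (b 0).2 = axisSpin := by rw [hb0]
  have hn := hasDerivAt_norm_of_axis hρ hr' hr0
  have hn0 : ‖(a 0).1 - (b 0).1‖ = ρ := by rw [hr0]; simp [abs_of_pos hρ]
  have hmm := hasDerivAt_inner_spins hma.hasDerivAt hmb.hasDerivAt hma0 hmb0
  have hmr := hasDerivAt_inner_spin_axis hma.hasDerivAt hma0 hr' hr0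
  have hmr2 := hasDerivAt_inner_spin_axis hmb.hasDerivAt hmb0 hr' hr0
  have hpow : ∀ s : ℝ, HasDerivAt (fun t => ‖(a t).1 - (b t).1‖ ^ s) _ 0 := fun s =>
    hn.rpow_const (p := s) (Or.inl (by rw [hn0]; exact hρ.ne'))
  have hne : ∀ s : ℝ, ‖(a 0).1 - (b 0).1‖ ^ s ≠ 0 := fun s => by
    rw [hn0]; positivity
  have h1 := (hmm.div (hpow β) (hne β)).const_mul B₀
  have h2 := ((hmr.mul hmr2).div (hpow (β + 2)) (hne (β + 2))).const_mul (B + B₀)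
  have h3 := ((hasDerivAt_const (0 : ℝ) (1 : ℝ)).div (hpow α) (hne α)).const_mul A
  have h := (h1.sub h2).add h3
  have e1 : inner ℝ ((a 0).2 : E3) ((b 0).2 : E3) = 1 := by
    rw [hma0, hmb0, axisSpin, inner_axis_left]; simp
  have e2 : inner ℝ ((a 0).2 : E3) ((a 0).1 - (b 0).1) = ρ := by
    rw [hma0, hr0, axisSpin, inner_axis_left]; simp
  have e3 : inner ℝ ((b 0).2 : E3) ((a 0).1 - (b 0).1) = ρ := by
    rw [hmb0, hr0, axisSpin, inner_axis_left]; simp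
  refine HasDerivAt.congr_deriv (f := fun t => dipolarPair B B₀ β (a t) (b t) +
    repulsivePair A α (a t) (b t)) h ?_
  simp only [Pi.mul_apply, e1, e2, e3, hn0, PiLp.sub_apply]
  generalize deriv (fun t => (a t).1) 0 0 - deriv (fun t => (b t).1) 0 0 = v
  have p1 : ∀ s : ℝ, ρ ^ (s - 1) = ρ ^ s / ρ := fun s => Real.rpow_sub_one hρ.ne' s
  have p2 : ρ ^ (β + 2) = ρ ^ β * ρ ^ 2 := by
    rw [Real.rpow_add hρ]; norm_num
  have p3 : ∀ s : ℝ, ρ ^ (-(s + 1)) = (ρ ^ s * ρ)⁻¹ := fun s => by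
    rw [Real.rpow_neg hρ.le, Real.rpow_add_one hρ.ne']
  have p4 : 0 < ρ ^ β := by positivity
  have p5 : 0 < ρ ^ α := by positivity
  unfold axialForce
  rw [p1, p1, p1, p2, p3, p3]
  field_simp
  ring

lemma hasDerivAt_energy (A B B₀ α β : ℝ) {N : ℕ} {P : Fin N → ℝ} (hP : StrictMono P)
    {γ : ℝ → Config N} (h0 : γ 0 = spear P)
    (hx : ∀ k, DifferentiableAt ℝ (fun t => (γ t k).1) 0)
    (hm : ∀ k, DifferentiableAt ℝ (fun t => ((γ t k).2 : E3)) 0) :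
    HasDerivAt (fun t => energy A B B₀ α β (γ t))
      (∑ k : Fin N, ∑ l ∈ Finset.Iio k, axialForce A B α β (P k - P l) *
        (deriv (fun t => (γ t k).1) 0 0 - deriv (fun t => (γ t l).1) 0 0)) 0 := by
  simp only [energy, ← Finset.sum_add_distrib]
  refine HasDerivAt.fun_sum fun k _ => HasDerivAt.fun_sum fun l hl => ?_
  exact hasDerivAt_pair A B B₀ α β (hP (Finset.mem_Iio.1 hl)) (by rw [h0]; rfl) (by rw [h0]; rfl)
    (hx k) (hx l) (hm k) (hm l)

lemma collisionFree_spear_iff {N : ℕ} {P : Fin N → ℝ} :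
    CollisionFree (spear P) ↔ Function.Injective P := by
  have h : ∀ x y : ℝ, (EuclideanSpace.single 0 x : E3) = EuclideanSpace.single 0 y ↔ x = y :=
    fun x y => by
      refine ⟨fun h => ?_, fun h => by rw [h]⟩
      simpa using congrArg (fun v : E3 => v 0) h
  simp only [CollisionFree, Function.Injective, spear, h]

lemma IsCriticalSpear.strictMono {A B B₀ α β : ℝ} {N : ℕ} {P : Fin N → ℝ}
    (h : IsCriticalSpear A B B₀ α β P) : StrictMono P :=
  h.1.strictMono_of_injective (collisionFree_spear_iff.1 h.2.1)

lemma hasDerivAt_energy_spear (A B B₀ α β : ℝ) {N : ℕ} {P : Fin N → ℝ} (hP : StrictMono P)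
    (v : Fin N → ℝ) :
    HasDerivAt (fun t : ℝ => energy A B B₀ α β (spear fun k => P k + t * v k))
      (∑ k : Fin N, ∑ l ∈ Finset.Iio k, axialForce A B α β (P k - P l) * (v k - v l)) 0 := by
  have hd : ∀ k, HasDerivAt (fun t : ℝ => (EuclideanSpace.single 0 (P k + t * v k) : E3))
      (EuclideanSpace.single 0 (v k)) 0 := by
    intro k
    have h1 : HasDerivAt (fun t : ℝ => EuclideanSpace.single 0 (P k) +
        t • (EuclideanSpace.single 0 (v k) : E3)) ((1 : ℝ) • EuclideanSpace.single 0 (v k)) 0 :=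
      ((hasDerivAt_id (0 : ℝ)).smul_const _).const_add _
    rw [one_smul] at h1
    refine h1.congr_of_eventuallyEq (Filter.Eventually.of_forall fun t => ?_)
    ext i
    fin_cases i <;> simp
  have h := hasDerivAt_energy A B B₀ α β hP (γ := fun t => spear fun k => P k + t * v k)
    (by simp) (fun k => (hd k).differentiableAt) (fun k => differentiableAt_const _)
  refine h.congr_deriv ?_
  simp only [spear, (hd _).deriv]
  simp

/-- A spear is critical as soon as it is critical among spears. -/
lemma isCriticalPoint_spear_iff {A B B₀ α β : ℝ} {N : ℕ} {P : Fin N → ℝ} (hP : StrictMono P) :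
    IsCriticalPoint A B B₀ α β (spear P) ↔ ∀ v : Fin N → ℝ,
      ∑ k : Fin N, ∑ l ∈ Finset.Iio k, axialForce A B α β (P k - P l) * (v k - v l) = 0 := by
  constructor
  · rintro ⟨-, h⟩ v
    have hd : ∀ k, DifferentiableAt ℝ
        (fun t : ℝ => (EuclideanSpace.single 0 (P k + t * v k) : E3)) 0 := by
      intro k
      have : (fun t : ℝ => (EuclideanSpace.single 0 (P k + t * v k) : E3)) = fun t : ℝ =>
          EuclideanSpace.single 0 (P k) + t • (EuclideanSpace.single 0 (v k) : E3) := by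
        funext t
        ext i
        fin_cases i <;> simp
      rw [this]
      fun_prop
    exact (hasDerivAt_energy_spear A B B₀ α β hP v).unique
      (h (fun t => spear fun k => P k + t * v k) (by simp) hd fun k => differentiableAt_const _)
  · intro h
    refine ⟨collisionFree_spear_iff.2 hP.injective, fun γ h0 hx hm => ?_⟩
    have := hasDerivAt_energy A B B₀ α β hP h0 hx hm
    rwa [h fun k => deriv (fun t => (γ t k).1) 0 0] at this

/-! ### Normalization -/

section Normalization

variable {A B α β : ℝ}

lemma hHat_pos (hA : 0 < A) (hB : 0 < B) (hβ : 1 < β) (hαβ : β < α) : 0 < hHat A B α β := by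
  have : 0 < α := by linarith
  unfold hHat
  positivity

/-- `hHat` is the distance at which attraction and repulsion of a pair cancel, so rescaling by it
removes `A` and `B` up to a positive factor. -/
lemma axialForce_mul (hA : 0 < A) (hB : 0 < B) (hβ : 1 < β) (hαβ : β < α) {r : ℝ} (hr : 0 < r) :
    axialForce A B α β (hHat A B α β * r) =
      β * B * hHat A B α β ^ (-(β + 1)) * pairForce α β r := by
  have hα : 0 < α := by linarith
  have hH := hHat_pos hA hB hβ hαβ
  have h1 : hHat A B α β ^ (α - β) = α * A / (β * B) := by
    unfold hHat
    rw [rpow_one_div_rpow (by positivity) (by linarith)]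
  have h2 : hHat A B α β ^ (-(β + 1)) = hHat A B α β ^ (-(α + 1)) * (α * A / (β * B)) := by
    rw [← h1, ← Real.rpow_add hH]
    ring_nf
  unfold axialForce pairForce
  rw [Real.mul_rpow hH.le hr.le, Real.mul_rpow hH.le hr.le, h2]
  field_simp

lemma hCheck_eq (hA : 0 < A) (hB : 0 < B) (hβ : 1 < β) (hαβ : β < α) :
    hCheck A B α β = hHat A B α β * minBond α β := by
  have hα : 0 < α := by linarith
  have := one_le_zeta hβ
  unfold hCheck hHat minBond
  rw [← Real.mul_rpow (by positivity) (by positivity)]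
  congr 1
  field_simp

lemma hBar_eq (hA : 0 < A) (hB : 0 < B) (hβ : 1 < β) (hαβ : β < α) :
    hBar A B α β = hHat A B α β * limitBond α β := by
  have hα : 0 < α := by linarith
  have := one_le_zeta hβ
  have := one_le_zeta (hβ.trans hαβ)
  unfold hBar hHat limitBond
  rw [← Real.mul_rpow (by positivity) (by positivity)]
  congr 1
  field_simp

end Normalization

/-! ### From criticality to force balance at every bond -/

lemma sum_fin_Iio {N : ℕ} (F : ℕ → ℕ → ℝ) :
    ∑ k : Fin N, ∑ l ∈ Finset.Iio k, F l k = ∑ k ∈ Finset.range N, ∑ l ∈ Finset.range k, F l k := by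
  rw [← Fin.sum_univ_eq_sum_range (fun k => ∑ l ∈ Finset.range k, F l k)]
  refine Finset.sum_congr rfl fun k _ => ?_
  have : Finset.range (k : ℕ) = (Finset.Iio k).map Fin.valEmbedding := by
    rw [Fin.map_valEmbedding_Iio]
    ext
    simp
  rw [this, Finset.sum_map]
  rfl

/-- A rigid shift of all particles beyond the bond changes only the distances of pairs that it
separates. -/
lemma sum_mul_indicator_eq_sum_bondBox {N p : ℕ} (F : ℕ → ℕ → ℝ) :
    ∑ k ∈ Finset.range N, ∑ l ∈ Finset.range k,
      F l k * ((if p < k then 1 else 0) - (if p < l then 1 else 0)) =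
      ∑ q ∈ bondBox p N, F q.1 q.2 := by
  rw [bondBox, Finset.sum_product_right]
  symm
  refine Finset.sum_subset_zero_on_sdiff (fun k hk => ?_) (fun k hk => ?_) (fun k hk => ?_)
  · rw [Finset.mem_Ico] at hk
    exact Finset.mem_range.2 hk.2
  · simp only [Finset.mem_sdiff, Finset.mem_range, Finset.mem_Ico] at hk
    refine Finset.sum_eq_zero fun l hl => ?_
    rw [Finset.mem_range] at hl
    rw [if_neg (by omega), if_neg (by omega)]
    simp
  · rw [Finset.mem_Ico] at hk
    refine Finset.sum_subset_zero_on_sdiff (fun l hl => ?_) (fun l hl => ?_) (fun l hl => ?_)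
    · rw [Finset.mem_range] at hl ⊢
      omega
    · simp only [Finset.mem_sdiff, Finset.mem_range] at hl
      rw [if_pos (by omega), if_pos (by omega)]
      simp
    · rw [Finset.mem_range] at hl
      rw [if_pos (by omega), if_neg (by omega)]
      simp

/-- The positions of a spear in units of the largest bond length, extended to `ℕ`. -/
noncomputable def normalizedPos (A B α β : ℝ) {N : ℕ} (P : Fin N → ℝ) (i : ℕ) : ℝ :=
  (if h : i < N then P ⟨i, h⟩ else 0) / hHat A B α β

lemma normalizedPos_val {A B α β : ℝ} {N : ℕ} (P : Fin N → ℝ) (i : Fin N) :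
    normalizedPos A B α β P i = P i / hHat A B α β := by
  simp [normalizedPos]

lemma IsCriticalSpear.balanced {A B B₀ α β : ℝ} (hA : 0 < A) (hB : 0 < B) (hβ : 1 < β)
    (hαβ : β < α) {N : ℕ} {P : Fin N → ℝ} (h : IsCriticalSpear A B B₀ α β P) :
    Balanced α β N (normalizedPos A B α β P) := by
  have hH := hHat_pos hA hB hβ hαβ
  have hP := h.strictMono
  have hlt : ∀ l k : Fin N, l < k → normalizedPos A B α β P l < normalizedPos A B α β P k := by
    intro l k hlk
    rw [normalizedPos_val, normalizedPos_val]
    exact div_lt_div_of_pos_right (hP hlk) hH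
  refine ⟨fun p hp => hlt ⟨p, by omega⟩ ⟨p + 1, hp⟩ (by simp), fun p hp => ?_⟩
  have h1 := (isCriticalPoint_spear_iff hP).1 h.2 fun k => if p < (k : ℕ) then 1 else 0
  set K := β * B * hHat A B α β ^ (-(β + 1)) with hK
  have hK0 : 0 < K := by positivity
  have h2 : ∑ k : Fin N, ∑ l ∈ Finset.Iio k, K * pairForce α β
      (normalizedPos A B α β P k - normalizedPos A B α β P l) *
      ((if p < (k : ℕ) then 1 else 0) - (if p < (l : ℕ) then 1 else 0)) = 0 := by
    refine Eq.trans ?_ h1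
    refine Finset.sum_congr rfl fun k _ => Finset.sum_congr rfl fun l hl => ?_
    have hlk := hlt l k (Finset.mem_Iio.1 hl)
    rw [← axialForce_mul hA hB hβ hαβ (sub_pos.2 hlk), normalizedPos_val, normalizedPos_val,
      ← sub_div, mul_div_cancel₀ _ hH.ne']
  rw [sum_fin_Iio fun l k => K * pairForce α β
      (normalizedPos A B α β P k - normalizedPos A B α β P l) *
      ((if p < k then 1 else 0) - (if p < l then 1 else 0)),
    sum_mul_indicator_eq_sum_bondBox fun l k => K * pairForce α β
      (normalizedPos A B α β P k - normalizedPos A B α β P l), ← Finset.mul_sum] at h2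
  exact (mul_eq_zero_iff_left hK0.ne').1 h2

lemma gap_eq {A B α β : ℝ} (hA : 0 < A) (hB : 0 < B) (hβ : 1 < β) (hαβ : β < α) {N : ℕ}
    {P : Fin N → ℝ} (hP : StrictMono P) {p : ℕ} (hp : p + 1 < N) :
    gap P (p + 1) hp = hHat A B α β *
      (normalizedPos A B α β P (p + 1) - normalizedPos A B α β P p) := by
  have hH := hHat_pos hA hB hβ hαβ
  have h1 : P ⟨p, by omega⟩ < P ⟨p + 1, hp⟩ := hP (by simp)
  rw [mul_sub, normalizedPos, normalizedPos, dif_pos hp, dif_pos (by omega),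
    mul_div_cancel₀ _ hH.ne', mul_div_cancel₀ _ hH.ne']
  simp only [gap, spear, single_sub_single, Nat.add_sub_cancel]
  rw [PiLp.norm_single, Real.norm_eq_abs, abs_sub_comm, abs_of_pos (sub_pos.2 h1)]

/-! ### Minimization of the energy among spears -/

/-- The energy of two aligned particles at distance `r`. -/
noncomputable def pairEnergy (A B α β r : ℝ) : ℝ :=
  A * r ^ (-α) - B * r ^ (-β)

lemma energy_spear (A B B₀ α β : ℝ) {N : ℕ} {P : Fin N → ℝ} (hP : Function.Injective P) :
    energy A B B₀ α β (spear P) =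
      ∑ k : Fin N, ∑ l ∈ Finset.Iio k, pairEnergy A B α β |P k - P l| := by
  simp only [energy, ← Finset.sum_add_distrib]
  refine Finset.sum_congr rfl fun k _ => Finset.sum_congr rfl fun l hl => ?_
  have hne : P k - P l ≠ 0 := sub_ne_zero.2 (hP.ne (Finset.mem_Iio.1 hl).ne')
  have hpos : 0 < |P k - P l| := abs_pos.2 hne
  have e1 : inner ℝ (axisSpin : E3) (axisSpin : E3) = 1 := by
    rw [axisSpin, inner_axis_left]; simp
  have e2 : inner ℝ (axisSpin : E3) (EuclideanSpace.single 0 (P k - P l)) = P k - P l := by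
    rw [axisSpin, inner_axis_left]; simp
  have e3 : ‖(EuclideanSpace.single 0 (P k - P l) : E3)‖ = |P k - P l| := by
    rw [PiLp.norm_single, Real.norm_eq_abs]
  simp only [dipolarPair, repulsivePair, spear, single_sub_single, e1, e2, e3, pairEnergy]
  have h1 : |P k - P l| ^ (β + 2) = |P k - P l| ^ β * ((P k - P l) * (P k - P l)) := by
    rw [Real.rpow_add hpos, Real.rpow_two, sq_abs, sq]
  have h2 : 0 < |P k - P l| ^ β := by positivity
  have h3 : 0 < |P k - P l| ^ α := by positivity
  rw [h1, Real.rpow_neg hpos.le, Real.rpow_neg hpos.le]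
  field_simp
  ring

/-- The symmetric form of the pair sum makes its invariance under permutations evident. -/
lemma two_mul_sum_Iio {N : ℕ} {G : Fin N → Fin N → ℝ} (hG : ∀ k l, G k l = G l k) :
    2 * ∑ k, ∑ l ∈ Finset.Iio k, G k l = ∑ k, ∑ l, if k = l then 0 else G k l := by
  have h1 : ∑ k, ∑ l ∈ Finset.Iio k, G k l = ∑ k, ∑ l, if l < k then G k l else 0 := by
    refine Finset.sum_congr rfl fun k _ => ?_
    rw [← Finset.sum_filter]
    congr 1
    ext
    simp
  have h2 : ∑ k, ∑ l, (if l < k then G k l else 0) = ∑ k, ∑ l, if k < l then G k l else 0 := by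
    rw [Finset.sum_comm]
    simp only [hG]
  rw [two_mul, h1]
  nth_rewrite 2 [h2]
  rw [← Finset.sum_add_distrib]
  refine Finset.sum_congr rfl fun k _ => ?_
  rw [← Finset.sum_add_distrib]
  refine Finset.sum_congr rfl fun l _ => ?_
  rcases lt_trichotomy k l with h | h | h
  · rw [if_neg h.not_gt, if_pos h, if_neg h.ne, zero_add]
  · subst h
    simp
  · rw [if_pos h, if_neg h.not_gt, if_neg h.ne', add_zero]

lemma energy_spear_perm (A B B₀ α β : ℝ) {N : ℕ} {P : Fin N → ℝ} (hP : Function.Injective P)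
    (σ : Equiv.Perm (Fin N)) :
    energy A B B₀ α β (spear (P ∘ σ)) = energy A B B₀ α β (spear P) := by
  rw [energy_spear _ _ _ _ _ hP, energy_spear _ _ _ _ _ (hP.comp σ.injective)]
  have h1 := two_mul_sum_Iio (G := fun k l => pairEnergy A B α β |P k - P l|)
    fun k l => by rw [abs_sub_comm]
  have h2 := two_mul_sum_Iio (G := fun k l => pairEnergy A B α β |(P ∘ σ) k - (P ∘ σ) l|)
    fun k l => by rw [abs_sub_comm]
  have h3 : (∑ k, ∑ l, if k = l then 0 else pairEnergy A B α β |(P ∘ σ) k - (P ∘ σ) l|) =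
      ∑ k, ∑ l, if k = l then 0 else pairEnergy A B α β |P k - P l| := by
    rw [← Equiv.sum_comp σ fun k => ∑ l, if k = l then 0 else pairEnergy A B α β |P k - P l|]
    refine Finset.sum_congr rfl fun k _ => ?_
    rw [← Equiv.sum_comp σ fun l => if σ k = l then 0 else pairEnergy A B α β |P (σ k) - P l|]
    simp
  linarith

section PairEnergy

variable {A B α β : ℝ}

lemma hasDerivAt_pairEnergy {r : ℝ} (hr : 0 < r) :
    HasDerivAt (pairEnergy A B α β) (axialForce A B α β r) r := by
  have h1 := (Real.hasDerivAt_rpow_const (x := r) (p := -α) (Or.inl hr.ne')).const_mul A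
  have h2 := (Real.hasDerivAt_rpow_const (x := r) (p := -β) (Or.inl hr.ne')).const_mul B
  refine (h1.sub h2).congr_deriv ?_
  rw [axialForce, neg_add', neg_add']
  ring

lemma axialForce_nonneg (hA : 0 < A) (hB : 0 < B) (hβ : 1 < β) (hαβ : β < α) {r : ℝ}
    (hr : hHat A B α β ≤ r) : 0 ≤ axialForce A B α β r := by
  have hH := hHat_pos hA hB hβ hαβ
  rw [← mul_div_cancel₀ r hH.ne', axialForce_mul hA hB hβ hαβ (div_pos (hH.trans_le hr) hH)]
  exact mul_nonneg (by positivity) (pairForce_nonneg hαβ ((one_le_div hH).2 hr))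

lemma axialForce_nonpos (hA : 0 < A) (hB : 0 < B) (hβ : 1 < β) (hαβ : β < α) {r : ℝ}
    (hr0 : 0 < r) (hr : r ≤ hHat A B α β) : axialForce A B α β r ≤ 0 := by
  have hH := hHat_pos hA hB hβ hαβ
  rw [← mul_div_cancel₀ r hH.ne', axialForce_mul hA hB hβ hαβ (div_pos hr0 hH)]
  refine mul_nonpos_of_nonneg_of_nonpos (by positivity) ?_
  have := Real.rpow_le_rpow_of_exponent_ge (div_pos hr0 hH) ((div_le_one hH).2 hr)
    (show -(α + 1) ≤ -(β + 1) by linarith)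
  unfold pairForce
  linarith

lemma pairEnergy_le_pairEnergy (hA : 0 < A) (hB : 0 < B) (hβ : 1 < β) (hαβ : β < α) {r r' : ℝ}
    (hr : hHat A B α β ≤ r) (hrr' : r ≤ r') : pairEnergy A B α β r ≤ pairEnergy A B α β r' := by
  have hH := hHat_pos hA hB hβ hαβ
  have hpos : ∀ x ∈ Set.Ici (hHat A B α β), 0 < x := fun x hx => hH.trans_le hx
  refine monotoneOn_of_deriv_nonneg (convex_Ici (hHat A B α β))
    (fun x hx => (hasDerivAt_pairEnergy (hpos x hx)).continuousAt.continuousWithinAt)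
    (fun x hx => (hasDerivAt_pairEnergy
      (hpos x (interior_subset hx))).differentiableAt.differentiableWithinAt)
    (fun x hx => ?_) hr (hr.trans hrr') hrr'
  have hx' := interior_subset hx
  rw [(hasDerivAt_pairEnergy (hpos x hx')).deriv]
  exact axialForce_nonneg hA hB hβ hαβ hx'

lemma pairEnergy_hHat_le (hA : 0 < A) (hB : 0 < B) (hβ : 1 < β) (hαβ : β < α) {r : ℝ}
    (hr : 0 < r) : pairEnergy A B α β (hHat A B α β) ≤ pairEnergy A B α β r := by
  rcases le_total (hHat A B α β) r with h | h
  · exact pairEnergy_le_pairEnergy hA hB hβ hαβ le_rfl h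
  · have hpos : ∀ x ∈ Set.Icc r (hHat A B α β), 0 < x := fun x hx => hr.trans_le hx.1
    refine antitoneOn_of_deriv_nonpos (convex_Icc r (hHat A B α β))
      (fun x hx => (hasDerivAt_pairEnergy (hpos x hx)).continuousAt.continuousWithinAt)
      (fun x hx => (hasDerivAt_pairEnergy
        (hpos x (interior_subset hx))).differentiableAt.differentiableWithinAt)
      (fun x hx => ?_) (Set.left_mem_Icc.2 h) (Set.right_mem_Icc.2 h) h
    have hx' := interior_subset hx
    rw [(hasDerivAt_pairEnergy (hpos x hx')).deriv]
    exact axialForce_nonpos hA hB hβ hαβ (hpos x hx') hx'.2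

lemma tendsto_pairEnergy (hA : 0 < A) (hβ : 1 < β) (hαβ : β < α) :
    Filter.Tendsto (pairEnergy A B α β) (nhdsWithin 0 (Set.Ioi 0)) Filter.atTop := by
  have h1 : Filter.Tendsto (fun r : ℝ => r ^ (-β) * (A * r ^ (-(α - β)) + -B))
      (nhdsWithin 0 (Set.Ioi 0)) Filter.atTop :=
    (tendsto_rpow_neg_nhdsGT_zero (by linarith)).atTop_mul_atTop₀
      (Filter.tendsto_atTop_add_const_right _ _
        ((tendsto_rpow_neg_nhdsGT_zero (by linarith)).const_mul_atTop hA))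
  refine h1.congr' ?_
  filter_upwards [self_mem_nhdsWithin] with r hr
  have hr' : 0 < r := hr
  have : r ^ (-α) = r ^ (-β) * r ^ (-(α - β)) := by
    rw [← Real.rpow_add hr']
    ring_nf
  rw [pairEnergy, this]
  ring

end PairEnergy

/-- The positions of a spear with bond lengths `h 0, h 1, …`. -/
def posOfBonds (N : ℕ) (h : ℕ → ℝ) (k : Fin N) : ℝ :=
  ∑ i ∈ Finset.range k, h i

lemma posOfBonds_sub {N : ℕ} (h : ℕ → ℝ) {l k : Fin N} (hlk : l ≤ k) :
    posOfBonds N h k - posOfBonds N h l = ∑ i ∈ Finset.Ico (l : ℕ) k, h i := by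
  rw [Finset.sum_Ico_eq_sub _ hlk]
  rfl

lemma sum_Ico_pos {h : ℕ → ℝ} (h0 : ∀ i, 0 < h i) {l k : ℕ} (hlk : l < k) :
    0 < ∑ i ∈ Finset.Ico l k, h i :=
  Finset.sum_pos (fun i _ => h0 i) ⟨l, Finset.mem_Ico.2 ⟨le_rfl, hlk⟩⟩

lemma strictMono_posOfBonds {N : ℕ} {h : ℕ → ℝ} (h0 : ∀ i, 0 < h i) :
    StrictMono (posOfBonds N h) := fun l k hlk => by
  have := sum_Ico_pos h0 hlk
  rw [← posOfBonds_sub h hlk.le] at this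
  linarith

lemma energy_posOfBonds (A B B₀ α β : ℝ) {N : ℕ} {h : ℕ → ℝ} (h0 : ∀ i, 0 < h i) :
    energy A B B₀ α β (spear (posOfBonds N h)) =
      ∑ k : Fin N, ∑ l ∈ Finset.Iio k, pairEnergy A B α β (∑ i ∈ Finset.Ico (l : ℕ) k, h i) := by
  rw [energy_spear _ _ _ _ _ (strictMono_posOfBonds h0).injective]
  refine Finset.sum_congr rfl fun k _ => Finset.sum_congr rfl fun l hl => ?_
  have hlk := Finset.mem_Iio.1 hl
  rw [posOfBonds_sub h hlk.le, abs_of_pos (sum_Ico_pos h0 hlk)]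

/-- The bond lengths of an ordered spear. -/
lemma exists_bonds {N : ℕ} {P : Fin N → ℝ} (hP : StrictMono P) {d : ℝ} (hd : 0 < d) :
    ∃ h : ℕ → ℝ, (∀ i, 0 < h i) ∧ (∀ i, N ≤ i + 1 → h i = d) ∧
      ∀ k l : Fin N, posOfBonds N h k - posOfBonds N h l = P k - P l := by
  set f : ℕ → ℝ := fun i => if hi : i < N then P ⟨i, hi⟩ else 0 with hf
  have hfP : ∀ i : Fin N, f i = P i := fun i => by simp [hf]
  -- The filler `d` beyond the last bond will be `hHat`, which keeps the padded sequence inside the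
  -- compact box of bond lengths.
  set h : ℕ → ℝ := fun i => if i + 1 < N then f (i + 1) - f i else d with hh
  have hpos : ∀ k : Fin N, posOfBonds N h k = P k - f 0 := by
    intro k
    rw [posOfBonds, ← hfP k, ← Finset.sum_range_sub]
    refine Finset.sum_congr rfl fun i hi => ?_
    rw [Finset.mem_range] at hi
    simp only [hh]
    rw [if_pos (by omega)]
  refine ⟨h, fun i => ?_, fun i hi => ?_, fun k l => ?_⟩
  · simp only [hh]
    split_ifs with hi
    · have : P ⟨i, by omega⟩ < P ⟨i + 1, hi⟩ := hP (by simp)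
      simp only [hf]
      rw [dif_pos hi, dif_pos (by omega)]
      linarith
    · exact hd
  · simp only [hh]
    rw [if_neg (by omega)]
  · rw [hpos, hpos]
    ring

section Minimize

variable {A B α β : ℝ} {N : ℕ}

/-- Shortening all long bonds to `hHat` does not increase the energy. -/
lemma energy_posOfBonds_min_le (hA : 0 < A) (hB : 0 < B) (hβ : 1 < β) (hαβ : β < α) (B₀ : ℝ)
    {h : ℕ → ℝ} (h0 : ∀ i, 0 < h i) :
    energy A B B₀ α β (spear (posOfBonds N fun i => min (h i) (hHat A B α β))) ≤
      energy A B B₀ α β (spear (posOfBonds N h)) := by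
  have hH := hHat_pos hA hB hβ hαβ
  have h0' : ∀ i, 0 < min (h i) (hHat A B α β) := fun i => lt_min (h0 i) hH
  rw [energy_posOfBonds _ _ _ _ _ h0, energy_posOfBonds _ _ _ _ _ h0']
  refine Finset.sum_le_sum fun k _ => Finset.sum_le_sum fun l _ => ?_
  -- A pair either spans no shortened bond and keeps its distance, or spans one of length `hHat`, so
  -- that both distances lie where the pair energy increases.
  by_cases hc : ∀ i ∈ Finset.Ico (l : ℕ) k, h i ≤ hHat A B α β
  · rw [Finset.sum_congr rfl fun i hi => min_eq_left (hc i hi)]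
  · push Not at hc
    obtain ⟨i, hi, hlt⟩ := hc
    refine pairEnergy_le_pairEnergy hA hB hβ hαβ ?_
      (Finset.sum_le_sum fun j _ => min_le_left _ _)
    have := Finset.single_le_sum (f := fun i => min (h i) (hHat A B α β))
      (fun j _ => (h0' j).le) hi
    simpa [min_eq_right hlt.le] using this

lemma continuousOn_energy_posOfBonds (B₀ : ℝ) {ε : ℝ} (hε : 0 < ε) (H : ℝ) :
    ContinuousOn (fun h : ℕ → ℝ => energy A B B₀ α β (spear (posOfBonds N h)))
      (Set.pi Set.univ fun _ => Set.Icc ε H) := by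
  have h0 : ∀ h ∈ Set.pi Set.univ fun _ : ℕ => Set.Icc ε H, ∀ i, 0 < h i := fun h hh i =>
    hε.trans_le (hh i (Set.mem_univ i)).1
  refine ContinuousOn.congr ?_ fun h hh => energy_posOfBonds A B B₀ α β (h0 h hh)
  refine continuousOn_finsetSum _ fun k _ => continuousOn_finsetSum _ fun l hl => ?_
  intro h hh
  have hc : ContinuousAt (fun h : ℕ → ℝ => ∑ i ∈ Finset.Ico (l : ℕ) k, h i) h :=
    (continuous_finsetSum _ fun i _ => continuous_apply i).continuousAt
  exact (ContinuousAt.comp (g := pairEnergy A B α β)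
    (hasDerivAt_pairEnergy (sum_Ico_pos (h0 h hh) (Fin.lt_def.1 (Finset.mem_Iio.1 hl)))).continuousAt
    hc).continuousWithinAt

/-- A short bond makes the energy large. -/
lemma pairEnergy_add_le_energy (hA : 0 < A) (hB : 0 < B) (hβ : 1 < β) (hαβ : β < α) (B₀ : ℝ)
    {h : ℕ → ℝ} (h0 : ∀ i, 0 < h i) {i : ℕ} (hi : i + 1 < N) :
    pairEnergy A B α β (h i) - pairEnergy A B α β (hHat A B α β) +
        ∑ k : Fin N, ∑ _l ∈ Finset.Iio k, pairEnergy A B α β (hHat A B α β) ≤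
      energy A B B₀ α β (spear (posOfBonds N h)) := by
  set E := pairEnergy A B α β (hHat A B α β)
  rw [energy_posOfBonds _ _ _ _ _ h0, ← le_sub_iff_add_le, ← Finset.sum_sub_distrib]
  simp only [← Finset.sum_sub_distrib]
  have hnn : ∀ k : Fin N, ∀ l ∈ Finset.Iio k,
      0 ≤ pairEnergy A B α β (∑ i ∈ Finset.Ico (l : ℕ) k, h i) - E := fun k l hl =>
    sub_nonneg.2 (pairEnergy_hHat_le hA hB hβ hαβ (sum_Ico_pos h0 (Fin.lt_def.1 (Finset.mem_Iio.1 hl))))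
  have h1 := Finset.single_le_sum
    (f := fun k : Fin N => ∑ l ∈ Finset.Iio k,
      (pairEnergy A B α β (∑ i ∈ Finset.Ico (l : ℕ) k, h i) - E))
    (fun k _ => Finset.sum_nonneg (hnn k)) (Finset.mem_univ ⟨i + 1, hi⟩)
  have h2 := Finset.single_le_sum (hnn ⟨i + 1, hi⟩)
    (show (⟨i, by omega⟩ : Fin N) ∈ Finset.Iio ⟨i + 1, hi⟩ by simp)
  refine le_trans ?_ (h2.trans h1)
  simp

lemma exists_minimizing_strictMono (hA : 0 < A) (hB : 0 < B) (hβ : 1 < β) (hαβ : β < α)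
    (B₀ : ℝ) (N : ℕ) :
    ∃ P : Fin N → ℝ, StrictMono P ∧ IsMinimizingSpear A B B₀ α β P := by
  set H := hHat A B α β with hHdef
  have hH : 0 < H := hHat_pos hA hB hβ hαβ
  -- Threshold for `pairEnergy_add_le_energy`: one bond of pair energy above `T` makes the spear
  -- worse than the equidistant one with bonds `H`.
  set T := energy A B B₀ α β (spear (posOfBonds N fun _ => H)) + pairEnergy A B α β H -
    ∑ k : Fin N, ∑ _l ∈ Finset.Iio k, pairEnergy A B α β H with hT
  obtain ⟨δ, hδ0, hδ⟩ := mem_nhdsGT_iff_exists_Ioo_subset.1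
    ((tendsto_pairEnergy (B := B) hA hβ hαβ).eventually_gt_atTop T)
  have hδ0' : 0 < δ := hδ0
  set ε := min δ H with hε
  have hε0 : 0 < ε := lt_min hδ0' hH
  -- Compact by Tychonoff, although the energy sees only the first `N - 1` coordinates.
  set K := Set.pi Set.univ fun _ : ℕ => Set.Icc ε H with hK
  have hHK : (fun _ => H) ∈ K := fun i _ => ⟨min_le_right _ _, le_rfl⟩
  obtain ⟨h, hhK, hmin⟩ := (isCompact_univ_pi fun _ : ℕ => isCompact_Icc).exists_isMinOn ⟨_, hHK⟩
    (continuousOn_energy_posOfBonds (A := A) (B := B) (α := α) (β := β) (N := N) B₀ hε0 H)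
  have h0 : ∀ i, 0 < h i := fun i => hε0.trans_le (hhK i (Set.mem_univ i)).1
  have hmono : StrictMono (posOfBonds N h) := strictMono_posOfBonds h0
  refine ⟨_, hmono, collisionFree_spear_iff.2 hmono.injective, fun Q hQ => ?_⟩
  rw [collisionFree_spear_iff] at hQ
  have hQs : StrictMono (Q ∘ Tuple.sort Q) :=
    (Tuple.monotone_sort Q).strictMono_of_injective (hQ.comp (Tuple.sort Q).injective)
  obtain ⟨g, g0, gH, hg⟩ := exists_bonds hQs hH
  have hEg : energy A B B₀ α β (spear (posOfBonds N g)) = energy A B B₀ α β (spear Q) := by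
    rw [← energy_spear_perm A B B₀ α β hQ (Tuple.sort Q), energy_spear _ _ _ _ _ hQs.injective,
      energy_spear _ _ _ _ _ (strictMono_posOfBonds g0).injective]
    simp only [hg]
  rw [← hEg]
  refine le_trans ?_ (energy_posOfBonds_min_le hA hB hβ hαβ B₀ g0)
  set g' : ℕ → ℝ := fun i => min (g i) H with hg'
  have g0' : ∀ i, 0 < g' i := fun i => lt_min (g0 i) hH
  by_cases hgK : g' ∈ K
  · exact hmin hgK
  · obtain ⟨i, hi⟩ : ∃ i, g' i < ε := by
      by_contra! hall
      exact hgK fun i _ => ⟨hall i, min_le_right _ _⟩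
    have hiN : i + 1 < N := by
      by_contra! hle
      have : g' i = H := by simp [hg', gH i hle]
      rw [this] at hi
      exact hi.not_ge (min_le_right _ _)
    have h1 := pairEnergy_add_le_energy hA hB hβ hαβ B₀ g0' hiN
    have h2 : T < pairEnergy A B α β (g' i) := hδ ⟨g0' i, hi.trans_le (min_le_left _ _)⟩
    have h3 := hmin hHK
    simp only [Set.mem_ofPred_eq] at h3
    rw [← hHdef] at h1
    linarith

/-- An ordered spear of minimal energy is critical. -/
lemma IsMinimizingSpear.isCriticalSpear {B₀ : ℝ} {P : Fin N → ℝ} (hP : StrictMono P)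
    (h : IsMinimizingSpear A B B₀ α β P) : IsCriticalSpear A B B₀ α β P := by
  refine ⟨hP.monotone, (isCriticalPoint_spear_iff hP).2 fun v => ?_⟩
  have hd := hasDerivAt_energy_spear A B B₀ α β hP v
  refine IsLocalMin.hasDerivAt_eq_zero ?_ hd
  -- Small variations keep the order, hence remain admissible competitors.
  have hlt : ∀ᶠ t in nhds (0 : ℝ), ∀ k l : Fin N, k < l → P k + t * v k < P l + t * v l := by
    refine Filter.eventually_all.2 fun k => Filter.eventually_all.2 fun l => ?_
    by_cases hkl : k < l
    · have h1 : ContinuousAt (fun t : ℝ => P k + t * v k) 0 := by fun_prop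
      have h2 : ContinuousAt (fun t : ℝ => P l + t * v l) 0 := by fun_prop
      filter_upwards [h1.eventually_lt h2 (by simpa using hP hkl)] with t ht _ using ht
    · exact Filter.Eventually.of_forall fun t hkl' => absurd hkl' hkl
  filter_upwards [hlt] with t ht
  have hinj : StrictMono fun k => P k + t * v k := fun k l => ht k l
  simpa using h.2 _ (collisionFree_spear_iff.2 hinj.injective)

end Minimize

/-! ### Back to the original units -/

section CriticalSpears

variable {A B B₀ α β : ℝ} {N : ℕ}

lemma IsCriticalSpear.gap_bounds (hA : 0 < A) (hB : 0 < B) (hβ : 1 < β) (hαβ : β < α)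
    {P : Fin N → ℝ} (h : IsCriticalSpear A B B₀ α β P) {k : ℕ} (hk : k < N) (hk1 : 1 ≤ k) :
    hCheck A B α β ≤ gap P k hk ∧ gap P k hk ≤ hHat A B α β := by
  obtain ⟨p, rfl⟩ := Nat.exists_eq_add_of_le' hk1
  have hH := hHat_pos hA hB hβ hαβ
  have hbal := h.balanced hA hB hβ hαβ
  rw [gap_eq hA hB hβ hαβ h.strictMono hk, hCheck_eq hA hB hβ hαβ]
  exact ⟨mul_le_mul_of_nonneg_left (minBond_le hβ hαβ (sub_pos.2 (hbal.lt_succ p hk))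
      (hbal.bond_rpow_le_zeta hβ hαβ hk)) hH.le,
    mul_le_of_le_one_right hH.le (hbal.bond_le_one hαβ hk)⟩

lemma IsCriticalSpear.eq_translate (hA : 0 < A) (hB : 0 < B) (h : StiffExponent α β)
    {P Q : Fin N → ℝ} (hP : IsCriticalSpear A B B₀ α β P) (hQ : IsCriticalSpear A B B₀ α β Q) :
    ∃ t : ℝ, ∀ i, Q i = P i + t := by
  have hH := hHat_pos hA hB h.one_lt h.lt
  have hbP := hP.balanced hA hB h.one_lt h.lt
  have hbQ := hQ.balanced hA hB h.one_lt h.lt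
  set y := normalizedPos A B α β P with hy
  set z := normalizedPos A B α β Q with hz
  have hyz : ∀ i, i < N → z i = y i + (z 0 - y 0) := by
    intro i
    induction i with
    | zero => intro _; ring
    | succ i ih =>
      intro hi
      have h1 := ih (by omega)
      have h2 := hbP.bond_eq h hbQ hi
      linarith
  refine ⟨hHat A B α β * (z 0 - y 0), fun i => ?_⟩
  have h1 := hyz i i.2
  rw [hy, hz, normalizedPos_val, normalizedPos_val, div_eq_iff hH.ne', add_mul,
    div_mul_cancel₀ _ hH.ne'] at h1
  rw [h1]
  ring

lemma exists_gap_bounds (hA : 0 < A) (hB : 0 < B) (B₀ : ℝ) (h : StiffExponent α β) :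
    ∃ c C : ℝ, 0 < c ∧ 0 < C ∧
      ∀ (N : ℕ) (P : Fin N → ℝ), IsCriticalSpear A B B₀ α β P →
        ∀ (k : ℕ) (hk : k < N), 1 ≤ k →
          hBar A B α β + c / (N : ℝ) ^ (β - 1) ≤ gap P k hk ∧
          gap P k hk ≤ hBar A B α β +
            C * (1 / (N : ℝ) ^ (β - 1) + 1 / (k : ℝ) ^ (β - 1) +
              1 / ((N : ℝ) - (k : ℝ)) ^ (β - 1)) := by
  have hβ := h.one_lt
  have hζ := one_le_zeta hβ
  have hH := hHat_pos hA hB hβ h.lt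
  obtain ⟨c, hc, hlow⟩ := exists_limitBond_add_le h
  have hD : 0 < zeta β * (1 + 1 / (β - 1)) := by
    have : 0 < β - 1 := by linarith
    positivity
  refine ⟨hHat A B α β * c, hHat A B α β * (zeta β * (1 + 1 / (β - 1))), by positivity,
    by positivity, fun N P hP k hk hk1 => ?_⟩
  obtain ⟨p, rfl⟩ := Nat.exists_eq_add_of_le' hk1
  have hbal := hP.balanced hA hB hβ h.lt
  have hpow : ∀ x : ℝ, 0 ≤ x → x ^ (1 - β) = 1 / x ^ (β - 1) := fun x hx => by
    rw [← neg_sub, Real.rpow_neg hx, one_div]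
  rw [gap_eq hA hB hβ h.lt hP.strictMono hk, hBar_eq hA hB hβ h.lt]
  constructor
  · have h1 := mul_le_mul_of_nonneg_left (hlow N _ hbal p hk) hH.le
    rw [hpow _ (by positivity)] at h1
    refine le_trans (le_of_eq ?_) h1
    ring
  · have h1 := hbal.bond_le_limitBond_add h (fun l hl =>
      le_trans (le_add_of_nonneg_right (by positivity)) (hlow N _ hbal l hl)) hk
    have hcast : ((N - 1 - p : ℕ) : ℝ) = (N : ℝ) - ((p + 1 : ℕ) : ℝ) := by
      rw [← Nat.cast_sub hk.le]
      congr 1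
      omega
    rw [endEffect, hpow _ (by positivity), hpow _ (by positivity), hcast] at h1
    have h2 := mul_le_mul_of_nonneg_left h1 hH.le
    -- The `N`-term of the upper bound is a nonnegative addition; the two end terms alone suffice.
    have h3 : 0 ≤ hHat A B α β * (zeta β * (1 + 1 / (β - 1))) * (1 / (N : ℝ) ^ (β - 1)) := by
      positivity
    linarith

end CriticalSpears

end MagneticChain

theorem theorem1 :
    -- parts (i) and (ii)
    (∀ A B B₀ α β : ℝ, 0 < A → 0 < B → 0 < B₀ → 1 < β → β < α → ∀ N : ℕ,
      (∃ P₀ : Fin N → ℝ,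
        IsCriticalSpear A B B₀ α β P₀ ∧ IsMinimizingSpear A B B₀ α β P₀) ∧
      (∀ P : Fin N → ℝ, IsCriticalSpear A B B₀ α β P →
        ∀ (k : ℕ) (hk : k < N), 1 ≤ k →
          hCheck A B α β ≤ gap P k hk ∧ gap P k hk ≤ hHat A B α β)) ∧
    -- part (iii)
    (∀ β : ℝ, 3 ≤ β → ∃ αstar : ℝ, ∀ A B B₀ α : ℝ, 0 < A → 0 < B → 0 < B₀ →
      β < α → αstar < α →
      (∀ (N : ℕ) (P Q : Fin N → ℝ),
        IsCriticalSpear A B B₀ α β P → IsCriticalSpear A B B₀ α β Q →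
          ∃ t : ℝ, ∀ i, Q i = P i + t) ∧
      ∃ c C : ℝ, 0 < c ∧ 0 < C ∧
        ∀ (N : ℕ) (P : Fin N → ℝ), IsCriticalSpear A B B₀ α β P →
          ∀ (k : ℕ) (hk : k < N), 1 ≤ k →
            hBar A B α β + c / (N : ℝ) ^ (β - 1) ≤ gap P k hk ∧
            gap P k hk ≤ hBar A B α β +
              C * (1 / (N : ℝ) ^ (β - 1) + 1 / (k : ℝ) ^ (β - 1) +
                1 / ((N : ℝ) - (k : ℝ)) ^ (β - 1))) := by

  refine ⟨fun A B B₀ α β hA hB _ hβ hαβ N => ⟨?_, fun P hP k hk hk1 => ?_⟩, fun β hβ => ?_⟩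
  · obtain ⟨P, hP, hmin⟩ := exists_minimizing_strictMono hA hB hβ hαβ B₀ N
    exact ⟨P, hmin.isCriticalSpear hP, hmin⟩
  · exact hP.gap_bounds hA hB hβ hαβ hk hk1
  · obtain ⟨αstar, hstar⟩ := Filter.eventually_atTop.1
      (eventually_stiffExponent (show 1 < β by linarith))
    refine ⟨αstar, fun A B B₀ α hA hB _ _ hα => ⟨fun N P Q hP hQ => ?_, ?_⟩⟩
    · exact hP.eq_translate hA hB (hstar α hα.le) hQ
    · exact exists_gap_bounds hA hB B₀ (hstar α hα.le)
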